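/- For an integer $r\ge 1$, let $T_r$ be the perfect binary tree of depth $r$ (every non-leaf vertex has exactly two children and every leaf has depth $r$), and let the glued binary tree $GT(r)$ be the graph obtained from two copies of $T_r$ by identifying each leaf of one copy with the corresponding leaf of the other. In a graph $G$, a geodesic is a shortest path between its endpoints. A set $S\subseteq V(G)$ is a mutual-visibility set if any two vertices of $S$ are joined by a geodesic with no internal vertex in $S$; it is a general position set if no geodesic of $G$ contains three distinct vertices of $S$. Let $\chi_{\mu}(G)$ (resp. $\chi_{gp}(G)$) denote the smallest number of colors in a coloring of $V(G)$ in which each color class is a mutual-visibility set (resp. a general position set); colorings need not be proper. If $r\ge 2$ is an integer such that $r\neq 2^{i-1}+2^{i-2}+i-2$ for every integer $i\ge 2$, then $$\chi_{gp}(GT(r))=\chi_{\mu}(GT(r)).$$ -/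

import Mathlib

namespace GluedTrees

/-! ### Visibility notions in a graph -/

section Graph

universe u
variable {V : Type u}

/-- A walk is a geodesic if its length is the distance between its endpoints
(such a walk is automatically a path). -/
def IsGeodesic (G : SimpleGraph V) {x y : V} (p : G.Walk x y) : Prop :=
  p.length = G.dist x y

/-- `S` is a mutual-visibility set: any two vertices of `S` are joined by a geodesic none of
whose internal vertices lies in `S`. -/
def IsMutualVisibilitySet (G : SimpleGraph V) (S : Set V) : Prop :=
  ∀ x ∈ S, ∀ y ∈ S, ∃ p : G.Walk x y,
    IsGeodesic G p ∧ ∀ z ∈ p.support, z ∈ S → z = x ∨ z = y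

/-- `S` is a general position set: no geodesic of `G` contains three distinct vertices of `S`. -/
def IsGeneralPositionSet (G : SimpleGraph V) (S : Set V) : Prop :=
  ∀ (a b : V) (p : G.Walk a b), IsGeodesic G p →
    ∀ x ∈ S, ∀ y ∈ S, ∀ z ∈ S, x ∈ p.support → y ∈ p.support → z ∈ p.support →
      x = y ∨ y = z ∨ x = z

/-- The vertices of `G` can be colored with `n` colors such that every color class is a
mutual-visibility set. -/
def MutualVisibilityColorable (G : SimpleGraph V) (n : ℕ) : Prop :=
  ∃ c : V → Fin n, ∀ k : Fin n, IsMutualVisibilitySet G {v | c v = k}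

/-- The vertices of `G` can be colored with `n` colors such that every color class is a
general position set. -/
def GeneralPositionColorable (G : SimpleGraph V) (n : ℕ) : Prop :=
  ∃ c : V → Fin n, ∀ k : Fin n, IsGeneralPositionSet G {v | c v = k}

/-- The mutual-visibility chromatic number `χ_μ(G)`. -/
noncomputable def mutualVisibilityChromaticNumber (G : SimpleGraph V) : ℕ :=
  sInf {n | MutualVisibilityColorable G n}

/-- The general position chromatic number `χ_gp(G)`. -/
noncomputable def generalPositionChromaticNumber (G : SimpleGraph V) : ℕ :=
  sInf {n | GeneralPositionColorable G n}

/-- On a finite graph the number `χ_μ(G)` is attained, so it is a genuine minimum. -/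
theorem isLeast_mutualVisibilityChromaticNumber [Finite V] (G : SimpleGraph V) :
    IsLeast {n | MutualVisibilityColorable G n} (mutualVisibilityChromaticNumber G) := by
  have hne : {n | MutualVisibilityColorable G n}.Nonempty := by
    refine ⟨Nat.card V, Finite.equivFin V, fun k x hx y hy => ?_⟩
    obtain rfl : x = y := (Finite.equivFin V).injective (hx.trans hy.symm)
    exact ⟨SimpleGraph.Walk.nil, by simp [IsGeodesic], by simp⟩
  exact ⟨Nat.sInf_mem hne, fun n hn => Nat.sInf_le hn⟩

/-- On a finite graph the number `χ_gp(G)` is attained, so it is a genuine minimum. -/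
theorem isLeast_generalPositionChromaticNumber [Finite V] (G : SimpleGraph V) :
    IsLeast {n | GeneralPositionColorable G n} (generalPositionChromaticNumber G) := by
  have hne : {n | GeneralPositionColorable G n}.Nonempty := by
    refine ⟨Nat.card V, Finite.equivFin V, fun k a b p _ x hx y hy z _ _ _ _ => Or.inl ?_⟩
    exact (Finite.equivFin V).injective (hx.trans hy.symm)
  exact ⟨Nat.sInf_mem hne, fun n hn => Nat.sInf_le hn⟩

end Graph

/-! ### Perfect trees and glued trees -/

/-- The vertices of the perfect `t`-ary tree of depth `r`: a vertex of depth `d` is the word of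
length `d ≤ r` recording the choices of children on the way from the root, last choice first;
the root is the empty word and the leaves are the words of length `r`. -/
abbrev TreeVertex (r t : ℕ) : Type := {w : List (Fin t) // w.length ≤ r}

/-- The perfect `t`-ary tree of depth `r`: the children of `w` are the words `a :: w`. -/
def perfectTree (r t : ℕ) : SimpleGraph (TreeVertex r t) where
  Adj x y := (∃ a : Fin t, y.1 = a :: x.1) ∨ (∃ a : Fin t, x.1 = a :: y.1)
  symm := ⟨fun _ _ h => h.symm⟩
  loopless := ⟨fun x h => by rcases h with ⟨a, h⟩ | ⟨a, h⟩ <;> simpa using congrArg List.length h⟩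

/-- The vertices of the glued tree: two copies (indexed by `Bool`) of every non-leaf vertex of the
perfect tree, and one copy of every leaf (the quasi-leaves). -/
inductive GluedVertex (r t : ℕ) : Type
  | inner (copy : Bool) (w : List (Fin t)) (hw : w.length < r)
  | quasiLeaf (w : List (Fin t)) (hw : w.length = r)

/-- The embedding of the first (`false`) or second (`true`) copy of the perfect tree. -/
def copyEmb (r t : ℕ) (copy : Bool) (x : TreeVertex r t) : GluedVertex r t :=
  if h : x.1.length < r then .inner copy x.1 h
  else .quasiLeaf x.1 (le_antisymm x.2 (not_lt.mp h))

/-- The glued `t`-ary tree `GT(r, t)`: two copies of the perfect `t`-ary tree of depth `r`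
with corresponding leaves identified. -/
def gluedTree (r t : ℕ) : SimpleGraph (GluedVertex r t) :=
  (perfectTree r t).map (copyEmb r t false) ⊔ (perfectTree r t).map (copyEmb r t true)

/-- The glued binary tree `GT(r) = GT(r, 2)`. -/
def gluedBinaryTree (r : ℕ) : SimpleGraph (GluedVertex r 2) := gluedTree r 2

instance (r t : ℕ) : Finite (GluedVertex r t) := by
  have : Finite (TreeVertex r t) := (List.finite_length_le (Fin t) r).to_subtype
  refine Finite.of_surjective (fun p : Bool × TreeVertex r t => copyEmb r t p.1 p.2) ?_
  rintro (⟨b, w, hw⟩ | ⟨w, hw⟩)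
  · exact ⟨(b, ⟨w, hw.le⟩), by simp [copyEmb, hw]⟩
  · exact ⟨(true, ⟨w, hw.le⟩), by simp [copyEmb, hw]⟩

end GluedTrees

-- A general position set is a mutual-visibility set (the graph is connected), so `χ_μ ≤ χ_gp`. It
-- remains to color with general position sets using no more colors than a lower bound for `χ_μ`
-- demands.
--
-- Lower bound: fix `1 ≤ t ≤ r` and give a vertex of depth `d` the weight `2 ^ (r - max d t)`.
-- Geodesics follow tree paths, so in each copy a visible set is essentially an antichain plus at
-- most one exceptional top word. Kraft's inequality bounds the antichain by `2 ^ r`; the cap bounds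
-- an exceptional vertex by `2 ^ (r - t)`. Hence every color class weighs at most `2 ^ r + 2 ^ (r -
-- t)` (`IsMutualVisibilitySet.totalWeight_le`). Comparison with the weight of the whole graph gives
-- `MutualVisibilityColorable.lower_bound`.
--
-- Upper bound: one depth of one copy stays in general position when a single shallower vertex of
-- the other copy is added. So the few vertices near the roots can be absorbed by the deep levels,
-- with `2(r - t) + 1` colors (`generalPositionColorable_odd`) or `2(r - t)` colors
-- (`generalPositionColorable_even`).
--
-- With `t` maximal for `2 ^ t + t ≤ r + 1`, one of the two colorings meets the bound unless `r = 2
-- ^ t + 2 ^ (t - 1) + t - 1`. There the bound allows `2(r - t)` colors, but the even coloring is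
-- one level short.

namespace GluedTrees

-- Tree paths and lowest common ancestors in terms of suffixes.

section Words

variable {α : Type*}

/-- `z` lies on the path between `x` and `y` in the tree of all words. -/
def Between (z x y : List α) : Prop :=
  (z <:+ x ∨ z <:+ y) ∧ ∀ a, ¬ ((a :: z) <:+ x ∧ (a :: z) <:+ y)

theorem exists_suffix_length_eq (w : List α) {k : ℕ} (hk : k ≤ w.length) :
    ∃ s, s <:+ w ∧ s.length = k :=
  ⟨w.drop (w.length - k), List.drop_suffix _ _, by simp; omega⟩

theorem Between.symm {z x y : List α} (h : Between z x y) : Between z y x :=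
  ⟨h.1.symm, fun a ha => h.2 a ha.symm⟩

theorem exists_cons_suffix {z s : List α} (h : z <:+ s) (hl : z.length < s.length) :
    ∃ a, (a :: z) <:+ s := by
  obtain ⟨t, rfl⟩ := h
  rcases List.eq_nil_or_concat t with rfl | ⟨t', a, rfl⟩
  · simp at hl
  · exact ⟨a, t', by simp⟩

theorem head_eq_of_cons_suffix {a b : α} {z x : List α} (ha : (a :: z) <:+ x)
    (hb : (b :: z) <:+ x) : a = b := by
  rcases List.suffix_or_suffix_of_suffix ha hb with h | h
  · exact (List.cons.inj (h.eq_of_length (by simp))).1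
  · exact (List.cons.inj (h.eq_of_length (by simp))).1.symm

theorem suffix_of_suffix_of_length_le {s t w : List α} (hs : s <:+ w) (ht : t <:+ w)
    (h : s.length ≤ t.length) : s <:+ t := List.suffix_of_suffix_length_le hs ht h

theorem Between.of_not {z x y : List α} {a : α} (hy : (a :: z) <:+ y) (hx : ¬ (a :: z) <:+ x) :
    Between z x y :=
  ⟨Or.inr ((List.suffix_cons a z).trans hy), fun _ hb => hx (head_eq_of_cons_suffix hy hb.2 ▸ hb.1)⟩

theorem Between.of_not_suffix {z x y : List α} (hy : z <:+ y) (hx : ¬ z <:+ x) :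
    Between z x y :=
  ⟨Or.inr hy, fun b hb => hx ((List.suffix_cons b z).trans hb.1)⟩

theorem Between.of_suffix {z x y : List α} (hx : x <:+ z) (hy : z <:+ y) : Between z x y :=
  ⟨Or.inr hy, fun b hb => by have := (hb.1.trans hx).length_le; simp at this⟩

theorem Between.step_up {z w v : List α} {a : α} (h : Between z (a :: w) v) (hz : z ≠ a :: w) :
    Between z w v :=
  ⟨h.1.imp (fun h => (List.suffix_cons_iff.mp h).resolve_left hz) id,
    fun b hb => h.2 b ⟨hb.1.trans (List.suffix_cons _ _), hb.2⟩⟩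

theorem Between.step_down {z w v : List α} {a : α} (h : Between z w v) (hz : z ≠ w) :
    Between z (a :: w) v := by
  refine ⟨h.1.imp (fun h => h.trans (List.suffix_cons _ _)) id, fun b hb => h.2 b ⟨?_, hb.2⟩⟩
  rcases List.suffix_cons_iff.mp hb.1 with h' | h'
  · exact absurd (List.cons.inj h').2 hz
  · exact h'

variable [DecidableEq α]

/-- The length of the longest common suffix of two words, that is, the depth of the lowest common
ancestor of two tree vertices. -/
def meet : List α → List α → ℕ
  | [], _ => 0
  | a :: w, v => if (a :: w) <:+ v then w.length + 1 else meet w v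

theorem meet_le_left (w v : List α) : meet w v ≤ w.length := by
  induction w with
  | nil => simp [meet]
  | cons a w ih => rw [meet]; split_ifs <;> simp; omega

theorem length_le_meet_iff {s w v : List α} (h : s <:+ w) :
    s.length ≤ meet w v ↔ s <:+ v := by
  induction w with
  | nil => obtain rfl := List.suffix_nil.mp h; simp
  | cons a w ih =>
    rw [meet]
    split_ifs with hv
    · exact ⟨fun _ => h.trans hv, fun _ => by simpa using h.length_le⟩
    · rcases List.suffix_cons_iff.mp h with rfl | h'
      · have := meet_le_left w v
        simp only [List.length_cons, hv, iff_false]; omega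
      · exact ih h'

theorem length_le_meet {s w v : List α} (h : s <:+ w) (h' : s <:+ v) : s.length ≤ meet w v :=
  (length_le_meet_iff h).mpr h'

theorem exists_common_suffix (w v : List α) :
    ∃ s, s <:+ w ∧ s <:+ v ∧ s.length = meet w v := by
  obtain ⟨s, hs, hl⟩ := exists_suffix_length_eq w (meet_le_left w v)
  exact ⟨s, hs, (length_le_meet_iff hs).mp hl.le, hl⟩

theorem meet_comm (w v : List α) : meet w v = meet v w := by
  apply le_antisymm
  · obtain ⟨s, h1, h2, h3⟩ := exists_common_suffix w v
    exact h3 ▸ length_le_meet h2 h1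
  · obtain ⟨s, h1, h2, h3⟩ := exists_common_suffix v w
    exact h3 ▸ length_le_meet h2 h1

theorem meet_le_right (w v : List α) : meet w v ≤ v.length := meet_comm w v ▸ meet_le_left v w

theorem meet_eq_left {w v : List α} (h : w <:+ v) : meet w v = w.length :=
  le_antisymm (meet_le_left w v) (length_le_meet List.suffix_rfl h)

theorem meet_eq_right {w v : List α} (h : v <:+ w) : meet w v = v.length := by
  rw [meet_comm, meet_eq_left h]

theorem suffix_of_length_le_meet {w v : List α} (h : w.length ≤ meet w v) : w <:+ v :=
  (length_le_meet_iff List.suffix_rfl).mp h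

/-- Two suffixes of `y` are comparable, so the shorter of the two common suffixes is a suffix of `x`
and of `z`. -/
theorem meet_ultra (x y z : List α) : min (meet x y) (meet y z) ≤ meet x z := by
  obtain ⟨s, h1, h2, h3⟩ := exists_common_suffix x y
  obtain ⟨s', h1', h2', h3'⟩ := exists_common_suffix y z
  rcases List.suffix_or_suffix_of_suffix h2 h1' with h | h
  · have := length_le_meet h1 (h.trans h2'); omega
  · have := length_le_meet (h.trans h1) h2'; omega

theorem meet_lt_of_ne {x y : List α} (h : x.length = y.length) (hne : x ≠ y) :
    meet x y < x.length := by
  by_contra hc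
  exact hne ((suffix_of_length_le_meet (not_lt.mp hc)).eq_of_length h)

theorem Between.meet_le {z x y : List α} (h : Between z x y) : meet x y ≤ z.length := by
  by_contra hc
  obtain ⟨s, h1, h2, h3⟩ := exists_common_suffix x y
  have hz : z <:+ s := by
    rcases h.1 with hz | hz
    · exact suffix_of_suffix_of_length_le hz h1 (by omega)
    · exact suffix_of_suffix_of_length_le hz h2 (by omega)
  obtain ⟨a, ha⟩ := exists_cons_suffix hz (by omega)
  exact h.2 a ⟨ha.trans h1, ha.trans h2⟩

theorem Between.meet_eq {z x y : List α} (h : Between z x y) (hz : z <:+ x) :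
    meet z y = meet x y := by
  apply le_antisymm
  · obtain ⟨s, h1, h2, h3⟩ := exists_common_suffix z y
    exact h3 ▸ length_le_meet (h1.trans hz) h2
  · obtain ⟨s, h1, h2, h3⟩ := exists_common_suffix x y
    have := h.meet_le
    exact h3 ▸ length_le_meet (suffix_of_suffix_of_length_le h1 hz (by omega)) h2

theorem Between.extend {z w v l : List α} (h : Between z w v) (hv : v <:+ l)
    (hm : meet w l = meet w v) : Between z w l := by
  refine ⟨h.1.imp id fun h => h.trans hv, fun a ha => h.2 a ⟨ha.1, ?_⟩⟩
  rw [← length_le_meet_iff ha.1, ← hm, length_le_meet_iff ha.1]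
  exact ha.2

end Words
-- Kraft's inequality.
section Kraft

/-- Kraft's inequality for binary words, scaled by `2 ^ r`. -/
theorem sum_two_pow_le_of_antichain {r : ℕ} (s : List (Fin 2)) (hs : s.length ≤ r)
    (A : Finset (List (Fin 2))) (hA : ∀ x ∈ A, ∀ y ∈ A, x <:+ y → x = y)
    (hsA : ∀ x ∈ A, s <:+ x) (hr : ∀ x ∈ A, x.length ≤ r) :
    ∑ x ∈ A, 2 ^ (r - x.length) ≤ 2 ^ (r - s.length) := by
  induction hm : r - s.length generalizing s A with
  | zero =>
    have hsub : A ⊆ {s} := fun x hx => by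
      have := (hsA x hx).eq_of_length (le_antisymm (hsA x hx).length_le (by have := hr x hx; omega))
      simp [this]
    calc ∑ x ∈ A, 2 ^ (r - x.length) ≤ ∑ x ∈ {s}, 2 ^ (r - x.length) :=
          Finset.sum_le_sum_of_subset hsub
      _ = 2 ^ 0 := by simp [hm]
  | succ m ih =>
    by_cases hsm : s ∈ A
    · have hsub : A ⊆ {s} := fun x hx => by simp [hA s hsm x hx (hsA x hx)]
      calc ∑ x ∈ A, 2 ^ (r - x.length) ≤ ∑ x ∈ {s}, 2 ^ (r - x.length) :=
            Finset.sum_le_sum_of_subset hsub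
        _ = 2 ^ (m + 1) := by simp [hm]
    · have key : ∀ a : Fin 2, ∑ x ∈ A with (a :: s) <:+ x, 2 ^ (r - x.length) ≤ 2 ^ m := fun a =>
        ih (a :: s) (by simp; omega) _
          (fun x hx y hy => hA x (Finset.mem_filter.mp hx).1 y (Finset.mem_filter.mp hy).1)
          (fun x hx => (Finset.mem_filter.mp hx).2) (fun x hx => hr x (Finset.mem_filter.mp hx).1)
          (by simp; omega)
      have hsub : A ⊆ (A.filter fun x => (0 :: s) <:+ x) ∪ (A.filter fun x => (1 :: s) <:+ x) := by
        intro x hx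
        have hlt : s.length < x.length := lt_of_le_of_ne (hsA x hx).length_le fun h =>
          hsm ((hsA x hx).eq_of_length h ▸ hx)
        obtain ⟨a, ha⟩ := exists_cons_suffix (hsA x hx) hlt
        have : a = 0 ∨ a = 1 := by omega
        rcases this with rfl | rfl <;> simp [hx, ha]
      calc ∑ x ∈ A, 2 ^ (r - x.length) ≤ _ := Finset.sum_le_sum_of_subset hsub
        _ ≤ _ := (Nat.le_add_right _ _).trans_eq Finset.sum_union_inter
        _ ≤ 2 ^ m + 2 ^ m := add_le_add (key 0) (key 1)
        _ = 2 ^ (m + 1) := by ring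

end Kraft

-- The weight of a visible configuration.

section Visible

/-- What mutual visibility says about the words `P` of the chosen vertices of one copy of the tree
and the words `Q` of those of the other copy. -/
structure Visible (P Q : Finset (List (Fin 2))) : Prop where
  left : ∀ x ∈ P, ∀ y ∈ P, ∀ z ∈ P, Between z x y → z = x ∨ z = y
  right : ∀ x ∈ Q, ∀ y ∈ Q, ∀ z ∈ Q, Between z x y → z = x ∨ z = y
  cross : ∀ w ∈ P, ∀ v ∈ Q, (w.length ≤ v.length ∧ ∀ z ∈ P, Between z w v → z = w) ∨
    (v.length ≤ w.length ∧ ∀ z ∈ Q, Between z w v → z = v)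

theorem Visible.symm {P Q : Finset (List (Fin 2))} (h : Visible P Q) : Visible Q P :=
  ⟨h.right, h.left, fun w hw v hv => (h.cross v hv w hw).symm.imp
    (And.imp_right fun h z hz hb => h z hz hb.symm) (And.imp_right fun h z hz hb => h z hz hb.symm)⟩

/-- No word of the set is a proper suffix of another one. -/
def IsSuffixFree (A : Finset (List (Fin 2))) : Prop := ∀ x ∈ A, ∀ y ∈ A, x <:+ y → x = y

/-- The words other than `w` are pairwise incomparable and lie below one child `a :: w` of `w`. -/
structure IsTopped (A : Finset (List (Fin 2))) (w : List (Fin 2)) (a : Fin 2) : Prop where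
  mem : w ∈ A
  below : ∀ x ∈ A.erase w, (a :: w) <:+ x
  free : IsSuffixFree (A.erase w)

/-- If `w` is a proper suffix of `y`, through the child `a :: w`, then `w` blocks `y` from every
word not below `a :: w`. A second comparable pair `x`, `y` inside that subtree would in the same way
place `w` below `x`. -/
theorem isSuffixFree_or_isTopped {A : Finset (List (Fin 2))}
    (h : ∀ x ∈ A, ∀ y ∈ A, ∀ z ∈ A, Between z x y → z = x ∨ z = y) :
    IsSuffixFree A ∨ ∃ w a, IsTopped A w a := by
  by_cases hA : IsSuffixFree A
  · exact Or.inl hA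
  have key : ∀ x ∈ A, ∀ y ∈ A, ∀ z ∈ A, ∀ a, z ≠ x → z ≠ y → (a :: z) <:+ y → (a :: z) <:+ x := by
    intro x hx y hy z hz a hzx hzy hy'
    by_contra hx'
    rcases h x hx y hy z hz (Between.of_not hy' hx') with h | h
    · exact hzx h
    · exact hzy h
  unfold IsSuffixFree at hA
  push Not at hA
  obtain ⟨w, hw, y, hy, hwy, hne⟩ := hA
  obtain ⟨a, ha⟩ := exists_cons_suffix hwy
    (lt_of_le_of_ne hwy.length_le fun h => hne (hwy.eq_of_length h))
  have hb : ∀ x ∈ A.erase w, (a :: w) <:+ x := fun x hx =>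
    key x (Finset.mem_of_mem_erase hx) y hy w hw a (Finset.ne_of_mem_erase hx).symm hne ha
  refine Or.inr ⟨w, a, hw, hb, fun x hx y hy hxy => ?_⟩
  by_contra hxy'
  obtain ⟨b, hb'⟩ := exists_cons_suffix hxy
    (lt_of_le_of_ne hxy.length_le fun h => hxy' (hxy.eq_of_length h))
  have h1 := key w hw y (Finset.mem_of_mem_erase hy) x (Finset.mem_of_mem_erase hx) b
    (Finset.ne_of_mem_erase hx) hxy' hb'
  have h2 := (hb x hx).length_le
  have h3 := h1.length_le
  simp at h2 h3
  omega

theorem IsSuffixFree.sum_add_sum_le {r : ℕ} {A B : Finset (List (Fin 2))} (hA : IsSuffixFree A)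
    (hB : IsSuffixFree B) (hAB : ∀ x ∈ A, ∀ y ∈ B, ¬ x <:+ y ∧ ¬ y <:+ x) (s : List (Fin 2))
    (hs : s.length ≤ r) (hsA : ∀ x ∈ A, s <:+ x) (hsB : ∀ x ∈ B, s <:+ x)
    (hrA : ∀ x ∈ A, x.length ≤ r) (hrB : ∀ x ∈ B, x.length ≤ r) :
    ∑ x ∈ A, 2 ^ (r - x.length) + ∑ x ∈ B, 2 ^ (r - x.length) ≤ 2 ^ (r - s.length) := by
  have hd : Disjoint A B := Finset.disjoint_left.mpr fun x hx hx' =>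
    (hAB x hx x hx').1 List.suffix_rfl
  rw [← Finset.sum_union hd]
  refine sum_two_pow_le_of_antichain s hs _ ?_ ?_ ?_
  · intro x hx y hy hxy
    rcases Finset.mem_union.mp hx with hx | hx <;> rcases Finset.mem_union.mp hy with hy | hy
    · exact hA x hx y hy hxy
    · exact absurd hxy (hAB x hx y hy).1
    · exact absurd hxy (hAB y hy x hx).2
    · exact hB x hx y hy hxy
  · exact fun x hx => (Finset.mem_union.mp hx).elim (hsA x) (hsB x)
  · exact fun x hx => (Finset.mem_union.mp hx).elim (hrA x) (hrB x)

/-- The weight of a word of length `d`, capped so that it never exceeds `2 ^ (r - t)`. -/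
def cappedWeight (r t d : ℕ) : ℕ := 2 ^ (r - max d t)

theorem cappedWeight_le (r t d : ℕ) : cappedWeight r t d ≤ 2 ^ (r - d) :=
  Nat.pow_le_pow_right (by norm_num) (by omega)

theorem cappedWeight_le_cap (r t d : ℕ) : cappedWeight r t d ≤ 2 ^ (r - t) :=
  Nat.pow_le_pow_right (by norm_num) (by omega)

variable {r t : ℕ} {P Q : Finset (List (Fin 2))}

/-- The total capped weight of a finite set of words. -/
def totalWeight (r t : ℕ) (A : Finset (List (Fin 2))) : ℕ := ∑ x ∈ A, cappedWeight r t x.length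

theorem totalWeight_le (A : Finset (List (Fin 2))) :
    totalWeight r t A ≤ ∑ x ∈ A, 2 ^ (r - x.length) :=
  Finset.sum_le_sum fun _ _ => cappedWeight_le _ _ _

theorem totalWeight_le_erase {A : Finset (List (Fin 2))} {w : List (Fin 2)} (hw : w ∈ A) :
    totalWeight r t A ≤ 2 ^ (r - t) + ∑ x ∈ A.erase w, 2 ^ (r - x.length) := by
  rw [totalWeight, ← Finset.add_sum_erase A _ hw]
  exact add_le_add (cappedWeight_le_cap _ _ _) (totalWeight_le _)

theorem IsSuffixFree.erase {A : Finset (List (Fin 2))} (h : IsSuffixFree A) (w : List (Fin 2)) :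
    IsSuffixFree (A.erase w) := fun x hx y hy =>
  h x (Finset.mem_of_mem_erase hx) y (Finset.mem_of_mem_erase hy)

/-- Only `p` can be comparable to words of the other side: `P.erase p ∪ Q` is an antichain, and `p`
costs at most the cap. -/
theorem Visible.totalWeight_le_of_suffix (h : Visible P Q) (hP : IsSuffixFree P)
    (hQ : IsSuffixFree Q) (hrP : ∀ x ∈ P, x.length ≤ r) (hrQ : ∀ x ∈ Q, x.length ≤ r)
    {p v : List (Fin 2)} (hp : p ∈ P) (hv : v ∈ Q) (hpv : p <:+ v) :
    totalWeight r t P + totalWeight r t Q ≤ 2 ^ r + 2 ^ (r - t) := by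
  have hfree : ∀ x ∈ P.erase p, ∀ y ∈ Q, ¬ x <:+ y ∧ ¬ y <:+ x := by
    intro x hx y hy
    have hxp := Finset.ne_of_mem_erase hx
    replace hx := Finset.mem_of_mem_erase hx
    refine ⟨fun hxy => ?_, fun hyx => ?_⟩
    · have hpy : ¬ p <:+ y := fun hpy => by
        rcases List.suffix_or_suffix_of_suffix hpy hxy with h' | h'
        · exact hxp (hP p hp x hx h').symm
        · exact hxp (hP x hx p hp h')
      have hxv : ¬ x <:+ v := fun hxv => by
        rcases List.suffix_or_suffix_of_suffix hpv hxv with h' | h'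
        · exact hxp (hP p hp x hx h').symm
        · exact hxp (hP x hx p hp h')
      have b1 : Between x p y := Between.of_not_suffix hxy fun h' => hxp (hP x hx p hp h')
      have b2 : Between p x v := Between.of_not_suffix hpv fun h' => hxp (hP p hp x hx h').symm
      have l1 := hpv.length_le
      have l2 := hxy.length_le
      rcases h.cross p hp y hy with h1 | h1
      · exact hxp (h1.2 x hx b1)
      rcases h.cross x hx v hv with h2 | h2
      · exact hxp (h2.2 p hp b2).symm
      -- The remaining alternatives give `|p| ≤ |v| ≤ |x| ≤ |y| ≤ |p|`.
      have hpv' : p = v := hpv.eq_of_length (by omega)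
      subst hpv'
      have hb : Between p p y := ⟨Or.inl List.suffix_rfl, fun a ha => by
        have := ha.1.length_le; simp at this⟩
      have := h1.2 p hv hb
      subst this
      exact hpy List.suffix_rfl
    · have hyv : y ≠ v := fun hyv => hxp (hP p hp x hx (hpv.trans (hyv ▸ hyx))).symm
      rcases h.cross x hx v hv with h1 | h1
      · exact hxp (h1.2 p hp (Between.of_not_suffix hpv
          fun h' => hxp (hP p hp x hx h').symm)).symm
      · exact hyv (h1.2 y hy (Between.of_not_suffix hyx fun h' => hyv (hQ y hy v hv h')).symm)
  have h1 := (hP.erase p).sum_add_sum_le hQ hfree [] (by simp) (by simp) (by simp)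
    (fun x hx => hrP x (Finset.mem_of_mem_erase hx)) hrQ
  have h2 := totalWeight_le_erase (r := r) (t := t) hp
  have h3 := totalWeight_le (r := r) (t := t) Q
  simp only [List.length_nil, Nat.sub_zero] at h1
  omega

theorem Visible.totalWeight_le_of_isSuffixFree (h : Visible P Q) (hP : IsSuffixFree P)
    (hQ : IsSuffixFree Q) (hrP : ∀ x ∈ P, x.length ≤ r) (hrQ : ∀ x ∈ Q, x.length ≤ r) :
    totalWeight r t P + totalWeight r t Q ≤ 2 ^ r + 2 ^ (r - t) := by
  by_cases h1 : ∃ p ∈ P, ∃ v ∈ Q, p <:+ v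
  · obtain ⟨p, hp, v, hv, hpv⟩ := h1
    exact h.totalWeight_le_of_suffix hP hQ hrP hrQ hp hv hpv
  by_cases h2 : ∃ p ∈ P, ∃ v ∈ Q, v <:+ p
  · obtain ⟨p, hp, v, hv, hpv⟩ := h2
    rw [add_comm]
    exact h.symm.totalWeight_le_of_suffix hQ hP hrQ hrP hv hp hpv
  push Not at h1 h2
  have h3 := hP.sum_add_sum_le hQ (fun x hx y hy => ⟨h1 x hx y hy, h2 x hx y hy⟩) [] (by simp)
    (by simp) (by simp) hrP hrQ
  have h4 := totalWeight_le (r := r) (t := t) P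
  have h5 := totalWeight_le (r := r) (t := t) Q
  simp only [List.length_nil, Nat.sub_zero] at h3
  exact (add_le_add h4 h5).trans (h3.trans (Nat.le_add_right _ _))

/-- With two exceptional words, the rest must fit in a subtree of depth `d ≥ 1`; the half of the
Kraft budget thus saved pays for the second cap. -/
theorem two_mul_two_pow_add_le (ht : 1 ≤ t) (htr : t ≤ r) {d m : ℕ} (hd : 1 ≤ d)
    (hm : m ≤ 2 ^ (r - d)) : 2 * 2 ^ (r - t) + m ≤ 2 ^ r + 2 ^ (r - t) := by
  have h1 : 2 ^ (r - t) ≤ 2 ^ (r - 1) := Nat.pow_le_pow_right (by norm_num) (by omega)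
  have h2 : 2 ^ (r - d) ≤ 2 ^ (r - 1) := Nat.pow_le_pow_right (by norm_num) (by omega)
  have h3 : 2 ^ r = 2 * 2 ^ (r - 1) := by rw [← pow_succ']; congr 1; omega
  omega

/-- Since `w` is shallower than `y`, the view from `w` to `y` is tested on the side of `P`, where
`x` would block it. -/
theorem IsTopped.not_suffix {w : List (Fin 2)} {a : Fin 2} (hP : IsTopped P w a)
    (h : Visible P Q) {x y : List (Fin 2)} (hx : x ∈ P.erase w) (hy : y ∈ Q) : ¬ x <:+ y := by
  intro hxy
  have hwx := (List.suffix_cons a w).trans (hP.below x hx)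
  have l1 := (hP.below x hx).length_le
  have l2 := hxy.length_le
  simp only [List.length_cons] at l1
  rcases h.cross w hP.mem y hy with h1 | h1
  · exact Finset.ne_of_mem_erase hx
      (h1.2 x (Finset.mem_of_mem_erase hx) (Between.of_suffix hwx hxy))
  · omega

/-- A word `v` of `Q` above some `x` is a second exception. It blocks `x` from every other `y` on
the side of `Q`, so they see each other on the side of `P`, past `w`: this forces `y` below `a ::
w`. -/
theorem Visible.totalWeight_le_of_isTopped (h : Visible P Q) (ht : 1 ≤ t) (htr : t ≤ r)
    {w : List (Fin 2)} {a : Fin 2} (hP : IsTopped P w a) (hQ : IsSuffixFree Q)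
    (hrP : ∀ x ∈ P, x.length ≤ r) (hrQ : ∀ x ∈ Q, x.length ≤ r) :
    totalWeight r t P + totalWeight r t Q ≤ 2 ^ r + 2 ^ (r - t) := by
  have hrX : ∀ x ∈ P.erase w, x.length ≤ r := fun x hx => hrP x (Finset.mem_of_mem_erase hx)
  have hno : ∀ x ∈ P.erase w, ∀ y ∈ Q, ¬ x <:+ y := fun x hx y hy => hP.not_suffix h hx hy
  have h2 := totalWeight_le_erase (r := r) (t := t) hP.mem
  by_cases hc : ∃ x ∈ P.erase w, ∃ v ∈ Q, v <:+ x
  · obtain ⟨x, hx, v, hv, hvx⟩ := hc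
    have hxv : ∀ x ∈ P.erase w, ∀ v ∈ Q, v <:+ x → v.length < x.length := fun x hx v hv hvx =>
      lt_of_le_of_ne hvx.length_le fun hl =>
        hno x hx v hv (hvx.eq_of_length hl ▸ List.suffix_rfl)
    have key : ∀ x ∈ P.erase w, ∀ v ∈ Q, v <:+ x → ∀ y ∈ Q.erase v,
        x.length ≤ y.length ∧ (a :: w) <:+ y := by
      intro x hx v hv hvx y hy
      have hyv := Finset.ne_of_mem_erase hy
      replace hy := Finset.mem_of_mem_erase hy
      rcases h.cross x (Finset.mem_of_mem_erase hx) y hy with h1 | h1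
      · refine ⟨h1.1, ?_⟩
        by_contra hn
        exact Finset.ne_of_mem_erase hx
          (h1.2 w hP.mem (Between.of_not (hP.below x hx) hn).symm).symm
      · exact absurd (h1.2 v hv (Between.of_not_suffix hvx
          fun h' => hyv (hQ v hv y hy h').symm).symm).symm hyv
    have hfree : ∀ x ∈ P.erase w, ∀ y ∈ Q.erase v, ¬ x <:+ y ∧ ¬ y <:+ x := by
      intro x' hx' y hy
      refine ⟨hno x' hx' y (Finset.mem_of_mem_erase hy), fun hyx => ?_⟩
      -- Exchanging the roles of `v` and `y` yields `|x| ≤ |y| < |x'| ≤ |v| < |x|`.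
      have l1 := (key x hx v hv hvx y hy).1
      have l2 := (key x' hx' y (Finset.mem_of_mem_erase hy) hyx v
        (Finset.mem_erase.mpr ⟨(Finset.ne_of_mem_erase hy).symm, hv⟩)).1
      have l3 := hxv x hx v hv hvx
      have l4 := hxv x' hx' y (Finset.mem_of_mem_erase hy) hyx
      omega
    have h1 := hP.free.sum_add_sum_le (hQ.erase v) hfree (a :: w)
      ((hP.below x hx).length_le.trans (hrX x hx)) hP.below
      (fun y hy => (key x hx v hv hvx y hy).2) hrX
      (fun x hx => hrQ x (Finset.mem_of_mem_erase hx))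
    have h3 := totalWeight_le_erase (r := r) (t := t) hv
    have h4 := two_mul_two_pow_add_le ht htr (by simp) h1
    omega
  · push Not at hc
    have h1 := hP.free.sum_add_sum_le hQ (fun x hx y hy => ⟨hno x hx y hy, hc x hx y hy⟩) []
      (by simp) (by simp) (by simp) hrX hrQ
    have h3 := totalWeight_le (r := r) (t := t) Q
    simp only [List.length_nil, Nat.sub_zero] at h1
    omega

/-- If the two child subtrees under the tops were disjoint, `w` and `z` would block all views
between the remainders. So they are nested, and both remainders lie in the larger one. -/
theorem Visible.totalWeight_le_of_isTopped_isTopped (h : Visible P Q) (ht : 1 ≤ t) (htr : t ≤ r)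
    {w z : List (Fin 2)} {a b : Fin 2} (hP : IsTopped P w a) (hQ : IsTopped Q z b)
    (hrP : ∀ x ∈ P, x.length ≤ r) (hrQ : ∀ x ∈ Q, x.length ≤ r) :
    totalWeight r t P + totalWeight r t Q ≤ 2 ^ r + 2 ^ (r - t) := by
  have hrX : ∀ x ∈ P.erase w, x.length ≤ r := fun x hx => hrP x (Finset.mem_of_mem_erase hx)
  have hrY : ∀ x ∈ Q.erase z, x.length ≤ r := fun x hx => hrQ x (Finset.mem_of_mem_erase hx)
  have hno : ∀ x ∈ P.erase w, ∀ y ∈ Q.erase z, ¬ x <:+ y ∧ ¬ y <:+ x := fun x hx y hy =>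
    ⟨hP.not_suffix h hx (Finset.mem_of_mem_erase hy),
      hQ.not_suffix h.symm hy (Finset.mem_of_mem_erase hx)⟩
  have key : ∀ x ∈ P.erase w, ∀ y ∈ Q.erase z, (a :: w) <:+ y ∨ (b :: z) <:+ x := by
    intro x hx y hy
    by_contra hn
    push Not at hn
    rcases h.cross x (Finset.mem_of_mem_erase hx) y (Finset.mem_of_mem_erase hy) with h1 | h1
    · exact Finset.ne_of_mem_erase hx
        (h1.2 w hP.mem (Between.of_not (hP.below x hx) hn.1).symm).symm
    · exact Finset.ne_of_mem_erase hy
        (h1.2 z hQ.mem (Between.of_not (hQ.below y hy) hn.2)).symm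
  have hs : ∃ s : List (Fin 2), 1 ≤ s.length ∧ s.length ≤ r ∧ (∀ x ∈ P.erase w, s <:+ x) ∧
      ∀ y ∈ Q.erase z, s <:+ y := by
    by_cases hX : (P.erase w).Nonempty
    · by_cases hY : (Q.erase z).Nonempty
      · obtain ⟨x, hx⟩ := hX
        obtain ⟨y, hy⟩ := hY
        have hlx := (hP.below x hx).length_le.trans (hrX x hx)
        have hly := (hQ.below y hy).length_le.trans (hrY y hy)
        have hcmp : (a :: w) <:+ (b :: z) ∨ (b :: z) <:+ (a :: w) :=
          (key x hx y hy).elim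
            (fun h => List.suffix_or_suffix_of_suffix h (hQ.below y hy))
            (fun h => List.suffix_or_suffix_of_suffix (hP.below x hx) h)
        rcases hcmp with hc | hc
        · exact ⟨a :: w, by simp, hlx, hP.below, fun y hy => hc.trans (hQ.below y hy)⟩
        · exact ⟨b :: z, by simp, hly, fun x hx => hc.trans (hP.below x hx), hQ.below⟩
      · obtain ⟨x, hx⟩ := hX
        exact ⟨a :: w, by simp, (hP.below x hx).length_le.trans (hrX x hx), hP.below,
          fun y hy => absurd ⟨y, hy⟩ hY⟩
    · by_cases hY : (Q.erase z).Nonempty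
      · obtain ⟨y, hy⟩ := hY
        exact ⟨b :: z, by simp, (hQ.below y hy).length_le.trans (hrY y hy),
          fun y hy => absurd ⟨y, hy⟩ hX, hQ.below⟩
      -- Both remainders are empty; any word of length one serves.
      · exact ⟨[0], by simp, by simp; omega, fun y hy => absurd ⟨y, hy⟩ hX,
          fun y hy => absurd ⟨y, hy⟩ hY⟩
  obtain ⟨s, hs1, hs2, hs3, hs4⟩ := hs
  have h1 := hP.free.sum_add_sum_le hQ.free hno s hs2 hs3 hs4 hrX hrY
  have h2 := totalWeight_le_erase (r := r) (t := t) hP.mem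
  have h3 := totalWeight_le_erase (r := r) (t := t) hQ.mem
  have h4 := two_mul_two_pow_add_le ht htr hs1 h1
  omega

theorem Visible.totalWeight_add_le (h : Visible P Q) (ht : 1 ≤ t) (htr : t ≤ r)
    (hrP : ∀ x ∈ P, x.length ≤ r) (hrQ : ∀ x ∈ Q, x.length ≤ r) :
    totalWeight r t P + totalWeight r t Q ≤ 2 ^ r + 2 ^ (r - t) := by
  rcases isSuffixFree_or_isTopped h.left with hP | ⟨w, a, hP⟩ <;>
    rcases isSuffixFree_or_isTopped h.right with hQ | ⟨z, b, hQ⟩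
  · exact h.totalWeight_le_of_isSuffixFree hP hQ hrP hrQ
  · rw [add_comm]
    exact h.symm.totalWeight_le_of_isTopped ht htr hQ hP hrQ hrP
  · exact h.totalWeight_le_of_isTopped ht htr hP hQ hrP hrQ
  · exact h.totalWeight_le_of_isTopped_isTopped ht htr hP hQ hrP hrQ

end Visible
-- Distances and geodesics in the glued tree.
section Metric

variable {r : ℕ}

/-- The vertex of the glued tree given by a copy and a word of length at most `r`. -/
def vert (r : ℕ) (c : Bool) (w : List (Fin 2)) : GluedVertex r 2 :=
  if h : w.length < r then .inner c w h
  else .quasiLeaf (w.drop (w.length - r)) (by simp; omega)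

/-- The word of a vertex. -/
def wordOf : GluedVertex r 2 → List (Fin 2)
  | .inner _ w _ => w
  | .quasiLeaf w _ => w

/-- The copy in which a vertex lies (`false` on quasi-leaves). -/
def copyOf : GluedVertex r 2 → Bool
  | .inner c _ _ => c
  | .quasiLeaf _ _ => false

theorem vert_of_lt {c : Bool} {w : List (Fin 2)} (h : w.length < r) :
    vert r c w = .inner c w h := dif_pos h

theorem vert_of_eq {c : Bool} {w : List (Fin 2)} (h : w.length = r) :
    vert r c w = .quasiLeaf w h := by
  simp [vert, h]

theorem vert_copyOf_wordOf (x : GluedVertex r 2) : vert r (copyOf x) (wordOf x) = x := by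
  rcases x with ⟨c, w, h⟩ | ⟨w, h⟩
  · exact vert_of_lt h
  · exact vert_of_eq h

theorem length_wordOf_le (x : GluedVertex r 2) : (wordOf x).length ≤ r := by
  rcases x with ⟨c, w, h⟩ | ⟨w, h⟩
  · exact h.le
  · exact h.le

theorem wordOf_vert {c : Bool} {w : List (Fin 2)} (h : w.length ≤ r) :
    wordOf (vert r c w) = w := by
  rcases h.lt_or_eq with h | h
  · rw [vert_of_lt h]; rfl
  · rw [vert_of_eq h]; rfl

theorem copyOf_vert {c : Bool} {w : List (Fin 2)} (h : w.length < r) :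
    copyOf (vert r c w) = c := by
  rw [vert_of_lt h]; rfl

theorem vert_eq_of_length_eq {c c' : Bool} {w : List (Fin 2)} (h : w.length = r) :
    vert r c w = vert r c' w := by
  rw [vert_of_eq h, vert_of_eq h]

theorem copyEmb_eq_vert (c : Bool) (x : TreeVertex r 2) : copyEmb r 2 c x = vert r c x.1 := by
  rcases x.2.lt_or_eq with h | h
  · rw [vert_of_lt h, copyEmb, dif_pos h]
  · rw [vert_of_eq h, copyEmb, dif_neg (by omega)]

theorem gluedBinaryTree_adj_iff {x y : GluedVertex r 2} :
    (gluedBinaryTree r).Adj x y ↔ ∃ (c : Bool) (w : List (Fin 2)) (a : Fin 2), w.length < r ∧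
      ((x = vert r c w ∧ y = vert r c (a :: w)) ∨ (x = vert r c (a :: w) ∧ y = vert r c w)) := by
  have key : ∀ c : Bool, ((perfectTree r 2).map (copyEmb r 2 c)).Adj x y ↔
      ∃ (w : List (Fin 2)) (a : Fin 2), w.length < r ∧
      ((x = vert r c w ∧ y = vert r c (a :: w)) ∨ (x = vert r c (a :: w) ∧ y = vert r c w)) := by
    intro c
    rw [SimpleGraph.map_adj']
    constructor
    · rintro ⟨hne, ⟨u, hu⟩, ⟨v, hv⟩, ⟨a, ha⟩ | ⟨a, ha⟩, rfl, rfl⟩ <;>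
        simp only [copyEmb_eq_vert] <;> simp only at ha <;> subst ha
      · exact ⟨u, a, by simpa using hv, Or.inl ⟨rfl, rfl⟩⟩
      · exact ⟨v, a, by simpa using hu, Or.inr ⟨rfl, rfl⟩⟩
    · rintro ⟨w, a, hw, ⟨rfl, rfl⟩ | ⟨rfl, rfl⟩⟩
      · refine ⟨?_, ⟨w, hw.le⟩, ⟨a :: w, hw⟩, Or.inl ⟨a, rfl⟩, copyEmb_eq_vert _ _,
          copyEmb_eq_vert _ _⟩
        intro h
        have := congrArg (List.length ∘ wordOf) h
        simp [wordOf_vert hw.le, wordOf_vert (show (a :: w).length ≤ r from hw)] at this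
      · refine ⟨?_, ⟨a :: w, hw⟩, ⟨w, hw.le⟩, Or.inr ⟨a, rfl⟩, copyEmb_eq_vert _ _,
          copyEmb_eq_vert _ _⟩
        intro h
        have := congrArg (List.length ∘ wordOf) h
        simp [wordOf_vert hw.le, wordOf_vert (show (a :: w).length ≤ r from hw)] at this
  rw [gluedBinaryTree, gluedTree, SimpleGraph.sup_adj, key, key, Bool.exists_bool]

/-- The distance between the vertices given by two copies and two words. -/
def gluedDist (r : ℕ) (c : Bool) (w : List (Fin 2)) (c' : Bool) (v : List (Fin 2)) : ℤ :=
  if c = c' then w.length + v.length - 2 * meet w v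
  else 2 * r - 2 * meet w v - max (w.length : ℤ) v.length + min (w.length : ℤ) v.length

theorem gluedDist_eq_of_length_eq {c c' d : Bool} {w v : List (Fin 2)} (h : v.length = r)
    (hw : w.length ≤ r) : gluedDist r c w c' v = gluedDist r c w d v := by
  unfold gluedDist
  split_ifs <;> omega

theorem gluedDist_comm (c c' : Bool) (w v : List (Fin 2)) :
    gluedDist r c w c' v = gluedDist r c' v c w := by
  unfold gluedDist
  rw [meet_comm w v]
  rcases eq_or_ne c c' with h | h
  · simp only [h, if_true]; ring
  · rw [if_neg h, if_neg h.symm, max_comm, min_comm]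

theorem gluedDist_vert {c c' : Bool} {w v : List (Fin 2)} (hw : w.length ≤ r)
    (hv : v.length ≤ r) :
    gluedDist r c w (copyOf (vert r c' v)) v = gluedDist r c w c' v := by
  rcases hv.lt_or_eq with h | h
  · rw [copyOf_vert h]
  · exact gluedDist_eq_of_length_eq h hw

/-- This Lipschitz property along edges makes `gluedDist` a lower bound for walk lengths. -/
theorem gluedDist_cons {c c' : Bool} {w v : List (Fin 2)} {a : Fin 2} :
    gluedDist r c w c' (a :: v) ≤ gluedDist r c w c' v + 1 ∧
      gluedDist r c w c' v ≤ gluedDist r c w c' (a :: v) + 1 := by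
  unfold gluedDist
  by_cases h : (a :: v) <:+ w
  · have h1 := meet_eq_right h
    have h2 := meet_eq_right ((List.suffix_cons a v).trans h)
    have h3 := h.length_le
    simp only [List.length_cons] at *
    split_ifs <;> omega
  · have h1 : meet w (a :: v) = meet w v := by rw [meet_comm, meet, if_neg h, meet_comm]
    simp only [List.length_cons] at *
    split_ifs <;> omega

theorem gluedDist_le_add_one_of_adj {c : Bool} {w : List (Fin 2)} (hw : w.length ≤ r)
    {x y : GluedVertex r 2} (h : (gluedBinaryTree r).Adj x y) :
    gluedDist r c w (copyOf y) (wordOf y) ≤ gluedDist r c w (copyOf x) (wordOf x) + 1 := by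
  obtain ⟨d, v, a, hv, ⟨rfl, rfl⟩ | ⟨rfl, rfl⟩⟩ := gluedBinaryTree_adj_iff.mp h <;>
  · have hv' : (a :: v).length ≤ r := hv
    rw [wordOf_vert hv', wordOf_vert hv.le, gluedDist_vert hw hv', gluedDist_vert hw hv.le]
    have := gluedDist_cons (r := r) (c := c) (c' := d) (w := w) (v := v) (a := a)
    omega

theorem gluedDist_self (c : Bool) (w : List (Fin 2)) : gluedDist r c w c w = 0 := by
  rw [gluedDist, if_pos rfl, meet_eq_left List.suffix_rfl]; ring

/-- The distance in the glued tree, read off from words and copies. -/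
def vdist (x y : GluedVertex r 2) : ℤ := gluedDist r (copyOf x) (wordOf x) (copyOf y) (wordOf y)

theorem vdist_le_length {x y : GluedVertex r 2} (p : (gluedBinaryTree r).Walk y x) (z) :
    vdist z x ≤ vdist z y + p.length := by
  induction p with
  | nil => simp
  | cons h p ih =>
    have := gluedDist_le_add_one_of_adj (c := copyOf z) (w := wordOf z) (length_wordOf_le z) h
    simp only [SimpleGraph.Walk.length_cons, vdist] at *
    push_cast
    omega

theorem vdist_vert_vert {c c' : Bool} {w v : List (Fin 2)} (hw : w.length ≤ r)
    (hv : v.length ≤ r) : vdist (vert r c w) (vert r c' v) = gluedDist r c w c' v := by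
  rw [vdist, wordOf_vert hw, wordOf_vert hv, gluedDist_vert hw hv, gluedDist_comm,
    gluedDist_vert hv hw, gluedDist_comm]

theorem exists_walk_of_suffix (c : Bool) {s w : List (Fin 2)} (h : s <:+ w) (hw : w.length ≤ r) :
    ∃ p : (gluedBinaryTree r).Walk (vert r c s) (vert r c w),
      p.length = w.length - s.length := by
  obtain ⟨t, rfl⟩ := h
  induction t with
  | nil => exact ⟨SimpleGraph.Walk.nil, by simp⟩
  | cons a t ih =>
    obtain ⟨p, hp⟩ := ih (by simp at hw ⊢; omega)
    refine ⟨p.concat (gluedBinaryTree_adj_iff.mpr ⟨c, t ++ s, a, hw, Or.inl ⟨rfl, rfl⟩⟩), ?_⟩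
    rw [SimpleGraph.Walk.length_concat, hp]
    simp; omega

theorem exists_walk_of_length_le {c c' : Bool} {w v : List (Fin 2)} (hwv : w.length ≤ v.length)
    (hv : v.length ≤ r) : ∃ p : (gluedBinaryTree r).Walk (vert r c w) (vert r c' v),
      (p.length : ℤ) = gluedDist r c w c' v := by
  obtain ⟨s, h1, h2, h3⟩ := exists_common_suffix w v
  obtain ⟨p, hp⟩ := exists_walk_of_suffix c h1 (hwv.trans hv)
  have hsw := h1.length_le
  by_cases hc : c = c'
  · subst hc
    obtain ⟨q, hq⟩ := exists_walk_of_suffix c h2 hv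
    refine ⟨p.reverse.append q, ?_⟩
    rw [SimpleGraph.Walk.length_append, SimpleGraph.Walk.length_reverse, gluedDist, if_pos rfl]
    omega
  -- An arbitrary quasi-leaf below the deeper word `v`: the walk stays in copy `c` down to it and
  -- then climbs to `v` in copy `c'`.
  · let l : List (Fin 2) := List.replicate (r - v.length) 0 ++ v
    have hl : l.length = r := by simp [l]; omega
    have hvl : v <:+ l := List.suffix_append _ _
    obtain ⟨q, hq⟩ := exists_walk_of_suffix c (h2.trans hvl) hl.le
    obtain ⟨q', hq'⟩ := exists_walk_of_suffix c' hvl hl.le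
    refine ⟨p.reverse.append (q.append (q'.reverse.copy
      (vert_eq_of_length_eq hl) rfl)), ?_⟩
    simp only [SimpleGraph.Walk.length_append, SimpleGraph.Walk.length_reverse,
      SimpleGraph.Walk.length_copy, gluedDist, if_neg hc]
    omega

theorem exists_walk_length_eq_vdist (x y : GluedVertex r 2) :
    ∃ p : (gluedBinaryTree r).Walk x y, (p.length : ℤ) = vdist x y := by
  rw [← vert_copyOf_wordOf x, ← vert_copyOf_wordOf y,
    vdist_vert_vert (length_wordOf_le x) (length_wordOf_le y)]
  rcases le_total (wordOf x).length (wordOf y).length with h | h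
  · exact exists_walk_of_length_le h (length_wordOf_le y)
  · obtain ⟨p, hp⟩ := exists_walk_of_length_le (c := copyOf y) (c' := copyOf x) h
      (length_wordOf_le x)
    exact ⟨p.reverse, by rw [SimpleGraph.Walk.length_reverse, hp, gluedDist_comm]⟩

theorem gluedBinaryTree_reachable (x y : GluedVertex r 2) : (gluedBinaryTree r).Reachable x y :=
  (exists_walk_length_eq_vdist x y).choose.reachable

theorem dist_eq_vdist (x y : GluedVertex r 2) : ((gluedBinaryTree r).dist x y : ℤ) = vdist x y := by
  apply le_antisymm
  · obtain ⟨p, hp⟩ := exists_walk_length_eq_vdist x y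
    rw [← hp]
    exact_mod_cast SimpleGraph.dist_le p
  · obtain ⟨p, hp⟩ := (gluedBinaryTree_reachable x y).exists_walk_length_eq_dist
    have := vdist_le_length p x
    rw [show vdist x x = 0 from gluedDist_self _ _] at this
    omega

theorem vdist_triangle (x y z : GluedVertex r 2) : vdist x z ≤ vdist x y + vdist y z := by
  rw [← dist_eq_vdist, ← dist_eq_vdist, ← dist_eq_vdist]
  exact_mod_cast (gluedBinaryTree_reachable x y).dist_triangle_left z

theorem vdist_comm (x y : GluedVertex r 2) : vdist x y = vdist y x := gluedDist_comm _ _ _ _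

theorem vdist_le_walk_length {x y : GluedVertex r 2} (p : (gluedBinaryTree r).Walk x y) :
    vdist x y ≤ p.length := by
  rw [← dist_eq_vdist]
  exact_mod_cast SimpleGraph.dist_le p

theorem isGeodesic_iff {x y : GluedVertex r 2} (p : (gluedBinaryTree r).Walk x y) :
    IsGeodesic (gluedBinaryTree r) p ↔ (p.length : ℤ) = vdist x y := by
  rw [← dist_eq_vdist, Nat.cast_inj, IsGeodesic]

theorem IsGeodesic.of_append {x y z : GluedVertex r 2} {p : (gluedBinaryTree r).Walk x y}
    {q : (gluedBinaryTree r).Walk y z} (h : IsGeodesic (gluedBinaryTree r) (p.append q)) :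
    IsGeodesic (gluedBinaryTree r) p ∧ IsGeodesic (gluedBinaryTree r) q ∧
      vdist x y + vdist y z = vdist x z := by
  rw [isGeodesic_iff, SimpleGraph.Walk.length_append] at h
  rw [isGeodesic_iff, isGeodesic_iff]
  have h1 := vdist_le_walk_length p
  have h2 := vdist_le_walk_length q
  have h3 := vdist_triangle x y z
  omega

theorem IsGeodesic.reverse {x y : GluedVertex r 2} {p : (gluedBinaryTree r).Walk x y}
    (h : IsGeodesic (gluedBinaryTree r) p) : IsGeodesic (gluedBinaryTree r) p.reverse := by
  rw [isGeodesic_iff] at *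
  rw [SimpleGraph.Walk.length_reverse, h, vdist_comm]

theorem IsGeodesic.vdist_add {x y z : GluedVertex r 2} {p : (gluedBinaryTree r).Walk x y}
    (h : IsGeodesic (gluedBinaryTree r) p) (hz : z ∈ p.support) :
    vdist x z + vdist z y = vdist x y := by
  obtain ⟨q, q', rfl⟩ := SimpleGraph.Walk.mem_support_iff_exists_append.mp hz
  exact h.of_append.2.2

/-- Forgetting the copy projects the walk to a walk in one tree, which cannot avoid the tree path.
-/
theorem exists_mem_support_wordOf_eq {x y : GluedVertex r 2} (p : (gluedBinaryTree r).Walk x y)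
    {z : List (Fin 2)} (hz : Between z (wordOf x) (wordOf y)) :
    ∃ q ∈ p.support, wordOf q = z := by
  induction p with
  | @nil x =>
    rcases eq_or_ne z (wordOf x) with h | h
    · exact ⟨x, by simp, h.symm⟩
    · have hs := hz.1.elim id id
      obtain ⟨a, ha⟩ := exists_cons_suffix hs
        (lt_of_le_of_ne hs.length_le fun hl => h (hs.eq_of_length hl))
      exact absurd ⟨ha, ha⟩ (hz.2 a)
  | @cons x x' y hadj p ih =>
    rcases eq_or_ne z (wordOf x) with h | h
    · exact ⟨x, by simp, h.symm⟩
    · have hz' : Between z (wordOf x') (wordOf y) := by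
        obtain ⟨d, v, a, hv, ⟨rfl, rfl⟩ | ⟨rfl, rfl⟩⟩ := gluedBinaryTree_adj_iff.mp hadj <;>
        have hv' : (a :: v).length ≤ r := hv <;>
        rw [wordOf_vert hv'] at * <;> rw [wordOf_vert hv.le] at *
        · exact hz.step_down h
        · exact hz.step_up h
      obtain ⟨q, hq, hqz⟩ := ih hz'
      exact ⟨q, by simp [hq], hqz⟩

/-- The projected walk passes `z`; by the distance formula, passing it in the other copy would be a
strict detour. -/
theorem IsGeodesic.mem_support_of_between_of_lt {x y : GluedVertex r 2}
    {p : (gluedBinaryTree r).Walk x y} (h : IsGeodesic (gluedBinaryTree r) p) {c : Bool}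
    {w v z : List (Fin 2)} (hx : x = vert r c w) (hy : y = vert r c v) (hw : w.length < r)
    (hv : v.length ≤ r) (hz : Between z w v) : vert r c z ∈ p.support := by
  subst hx hy
  obtain ⟨q, hq, hqz⟩ := exists_mem_support_wordOf_eq p
    (by rwa [wordOf_vert hw.le, wordOf_vert hv] : Between z _ _)
  have hzr : z.length ≤ r := hqz ▸ length_wordOf_le q
  have hq' : vert r (copyOf q) z = q := hqz ▸ vert_copyOf_wordOf q
  rcases hzr.lt_or_eq with hlt | heq
  · rcases eq_or_ne c (copyOf q) with hc | hc
    · rwa [(congrArg (vert r · z) hc).trans hq']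
    · exfalso
      have hadd := h.vdist_add hq
      rw [← hq', vdist_vert_vert hw.le hzr, vdist_vert_vert hzr hv, vdist_vert_vert hw.le hv] at hadd
      simp only [gluedDist, if_neg hc, if_neg hc.symm, if_true] at hadd
      have h4 := meet_le_left w v
      have h5 := meet_le_right w v
      rcases hz.1 with hs | hs
      · have h1 := meet_eq_right hs
        have h2 := hz.meet_eq hs
        have h3 := hs.length_le
        omega
      · have h1 := meet_eq_left hs
        have h2 := hz.symm.meet_eq hs
        have h3 := hs.length_le
        rw [meet_comm z w, meet_comm v w] at h2
        omega
  · rwa [vert_eq_of_length_eq (c' := copyOf q) heq, hq']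

theorem IsGeodesic.mem_support_of_between {x y : GluedVertex r 2}
    {p : (gluedBinaryTree r).Walk x y} (h : IsGeodesic (gluedBinaryTree r) p) {c : Bool}
    {w v z : List (Fin 2)} (hx : x = vert r c w) (hy : y = vert r c v) (hw : w.length ≤ r)
    (hv : v.length ≤ r) (hwv : w.length < r ∨ v.length < r) (hz : Between z w v) :
    vert r c z ∈ p.support := by
  rcases hwv with h' | h'
  · exact h.mem_support_of_between_of_lt hx hy h' hv hz
  · simpa using h.reverse.mem_support_of_between_of_lt hy hx h' hw hz.symm

/-- The first edge selects the copy; what remains starts at an inner vertex. -/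
theorem IsGeodesic.exists_copy_of_length_eq {x y : GluedVertex r 2}
    {p : (gluedBinaryTree r).Walk x y} (h : IsGeodesic (gluedBinaryTree r) p)
    (hx : (wordOf x).length = r) (hy : (wordOf y).length = r) :
    ∃ d, ∀ z, Between z (wordOf x) (wordOf y) → vert r d z ∈ p.support := by
  have hx' : ∀ d, vert r d (wordOf x) = x := fun d =>
    (vert_eq_of_length_eq hx).trans (vert_copyOf_wordOf x)
  have hy' : ∀ d, vert r d (wordOf y) = y := fun d =>
    (vert_eq_of_length_eq hy).trans (vert_copyOf_wordOf y)
  cases p with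
  | nil =>
    refine ⟨false, fun z hz => ?_⟩
    obtain ⟨q, hq, rfl⟩ := exists_mem_support_wordOf_eq SimpleGraph.Walk.nil hz
    have : q = x := by simpa using hq
    subst this
    simpa using hx' false
  | @cons _ x' _ hadj p =>
    obtain ⟨d, v, a, hv, ⟨rfl, rfl⟩ | ⟨rfl, rfl⟩⟩ := gluedBinaryTree_adj_iff.mp hadj
    · rw [wordOf_vert hv.le] at hx
      omega
    · have hp : IsGeodesic (gluedBinaryTree r) p :=
        (IsGeodesic.of_append (p := SimpleGraph.Walk.cons hadj SimpleGraph.Walk.nil) (q := p)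
          (by simpa using h)).2.1
      refine ⟨d, fun z hz => ?_⟩
      have hv' : (a :: v).length ≤ r := hv
      rw [wordOf_vert hv'] at hz
      rcases eq_or_ne z (a :: v) with rfl | hne
      · simp
      · have := hp.mem_support_of_between_of_lt rfl (hy' d).symm hv hy.le (hz.step_up hne)
        simp [this]

theorem copyOf_eq_of_forall_support {x y : GluedVertex r 2} (p : (gluedBinaryTree r).Walk x y)
    (h : ∀ z ∈ p.support, (wordOf z).length < r) : copyOf x = copyOf y := by
  induction p with
  | nil => rfl
  | @cons x x' y hadj p ih =>
    rw [← ih fun z hz => h z (by simp [hz])]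
    have hx := h x (by simp)
    have hx' := h x' (by simp)
    obtain ⟨d, v, a, hv, ⟨rfl, rfl⟩ | ⟨rfl, rfl⟩⟩ := gluedBinaryTree_adj_iff.mp hadj
    all_goals
      have hv' : (a :: v).length ≤ r := hv
      rw [wordOf_vert hv.le] at *
      rw [wordOf_vert hv'] at *
      rw [copyOf_vert hv, copyOf_vert (by assumption)]

/-- To change copy, the geodesic visits a quasi-leaf, necessarily below the deeper endpoint. In the
copy of the shallower endpoint it therefore traces the whole tree path between the two words. -/
theorem IsGeodesic.mem_support_cross {x y : GluedVertex r 2}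
    {p : (gluedBinaryTree r).Walk x y} (h : IsGeodesic (gluedBinaryTree r) p) {c c' : Bool}
    {w v : List (Fin 2)} (hx : x = vert r c w) (hy : y = vert r c' v) (hc : c ≠ c')
    (hw : w.length ≤ r) (hv : v.length < r) :
    (w.length ≤ v.length ∧ ∀ z, Between z w v → vert r c z ∈ p.support) ∨
      (v.length ≤ w.length ∧ ∀ z, Between z w v → vert r c' z ∈ p.support) := by
  rcases hw.lt_or_eq with hw' | hw'
  swap
  · exact Or.inr ⟨by omega, fun z hz => h.mem_support_of_between
      (hx.trans (vert_eq_of_length_eq hw')) hy hw hv.le (Or.inr hv) hz⟩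
  subst hx hy
  obtain ⟨q, hq, hqr⟩ : ∃ q ∈ p.support, (wordOf q).length = r := by
    by_contra hn
    push Not at hn
    have := copyOf_eq_of_forall_support p
      fun z hz => lt_of_le_of_ne (length_wordOf_le z) (hn z hz)
    rw [copyOf_vert hw', copyOf_vert hv] at this
    exact hc this
  obtain ⟨l, hl⟩ : ∃ l, wordOf q = l := ⟨_, rfl⟩
  rw [hl] at hqr
  have hql : ∀ d, q = vert r d l := fun d =>
    (vert_copyOf_wordOf q).symm.trans (by rw [hl]; exact vert_eq_of_length_eq hqr)
  have hadd := h.vdist_add hq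
  rw [vdist_vert_vert hw hv.le] at hadd
  nth_rewrite 1 [hql c] at hadd
  rw [hql c', vdist_vert_vert hw hqr.le, vdist_vert_vert hqr.le hv.le] at hadd
  simp only [gluedDist, if_neg hc, if_true] at hadd
  have hu := meet_ultra w l v
  have h1 := meet_le_left w l
  have h2 := meet_le_right l v
  have hcase : (w.length ≤ v.length ∧ v.length ≤ meet v l ∧ meet w l = meet w v) ∨
      (v.length ≤ w.length ∧ w.length ≤ meet w l ∧ meet v l = meet v w) := by
    rw [meet_comm v l, meet_comm v w]
    omega
  obtain ⟨p₁, p₂, rfl⟩ := SimpleGraph.Walk.mem_support_iff_exists_append.mp hq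
  obtain ⟨g1, g2, -⟩ := h.of_append
  rcases hcase with ⟨hl1, hl2, hl3⟩ | ⟨hl1, hl2, hl3⟩
  · refine Or.inl ⟨hl1, fun z hz => ?_⟩
    have := g1.mem_support_of_between rfl (hql c) hw hqr.le (Or.inl hw')
      (hz.extend (suffix_of_length_le_meet hl2) hl3)
    exact SimpleGraph.Walk.support_subset_support_append_left _ _ this
  · refine Or.inr ⟨hl1, fun z hz => ?_⟩
    have := g2.mem_support_of_between (hql c') rfl hqr.le hv.le (Or.inr hv)
      (hz.symm.extend (suffix_of_length_le_meet hl2) hl3).symm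
    exact SimpleGraph.Walk.support_subset_support_append_right _ _ this

end Metric
-- The lower bound for mutual-visibility colorings.
section LowerBound

theorem Between.split {α : Type*} {z x y : List α} (h : Between z x y) (m : List α) :
    Between z x m ∨ Between z m y := by
  by_cases hm : z <:+ m
  · by_contra hn
    push Not at hn
    have h1 : ∃ a, (a :: z) <:+ x ∧ (a :: z) <:+ m := by
      by_contra h'
      exact hn.1 ⟨Or.inr hm, fun a ha => h' ⟨a, ha⟩⟩
    have h2 : ∃ a, (a :: z) <:+ m ∧ (a :: z) <:+ y := by
      by_contra h'
      exact hn.2 ⟨Or.inl hm, fun a ha => h' ⟨a, ha⟩⟩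
    obtain ⟨a, ha, ha'⟩ := h1
    obtain ⟨b, hb, hb'⟩ := h2
    obtain rfl := head_eq_of_cons_suffix ha' hb
    exact h.2 a ⟨ha, hb'⟩
  · rcases h.1 with hz | hz
    · exact Or.inl (Between.of_not_suffix hz hm).symm
    · exact Or.inr (Between.of_not_suffix hz hm)

/-- Endpoints are exchanged by `Between.split`. For quasi-leaves: if each copy blocks some pair, a
single pair is blocked in both. -/
theorem exists_between_both {α : Type*} {L : List α → Prop} {z z' x₁ y₁ x₂ y₂ : List α}
    (hx₁ : L x₁) (hy₁ : L y₁) (hx₂ : L x₂) (hy₂ : L y₂) (h₁ : Between z x₁ y₁)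
    (h₂ : Between z' x₂ y₂) : ∃ x y, L x ∧ L y ∧ Between z x y ∧ Between z' x y := by
  obtain ⟨m, hm, hb⟩ : ∃ m, L m ∧ Between z' x₁ m := by
    rcases h₂.split x₁ with h | h
    · exact ⟨x₂, hx₂, h.symm⟩
    · exact ⟨y₂, hy₂, h⟩
  rcases h₁.split m with h | h
  · exact ⟨x₁, m, hx₁, hm, h, hb⟩
  · rcases hb.split y₁ with h' | h'
    · exact ⟨x₁, y₁, hx₁, hy₁, h₁, h'⟩
    · exact ⟨m, y₁, hm, hy₁, h, h'.symm⟩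

/-- The binary words of length `d`. -/
def words : ℕ → Finset (List (Fin 2))
  | 0 => {[]}
  | d + 1 => (Finset.univ ×ˢ words d).image fun p => p.1 :: p.2

theorem mem_words {d : ℕ} {w : List (Fin 2)} : w ∈ words d ↔ w.length = d := by
  induction d generalizing w with
  | zero => simp [words]
  | succ d ih =>
    cases w with
    | nil => simp [words]
    | cons a w => simp [words, ih]

theorem card_words (d : ℕ) : (words d).card = 2 ^ d := by
  induction d with
  | zero => rfl
  | succ d ih =>
    rw [words, Finset.card_image_of_injective, Finset.card_product, ih, Finset.card_univ,
      Fintype.card_fin, pow_succ']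
    rintro ⟨a, w⟩ ⟨b, v⟩ h
    simpa using h

/-- The binary words of length less than `n`. -/
def wordsLT (n : ℕ) : Finset (List (Fin 2)) := (Finset.range n).biUnion words

theorem mem_wordsLT {n : ℕ} {w : List (Fin 2)} : w ∈ wordsLT n ↔ w.length < n := by
  simp [wordsLT, mem_words]

theorem disjoint_wordsLT_words (n : ℕ) : Disjoint (wordsLT n) (words n) :=
  Finset.disjoint_left.mpr fun w h h' => by rw [mem_wordsLT] at h; rw [mem_words] at h'; omega

theorem wordsLT_succ (n : ℕ) : wordsLT (n + 1) = wordsLT n ∪ words n := by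
  ext w
  simp only [Finset.mem_union, mem_wordsLT, mem_words]
  omega

theorem totalWeight_wordsLT_succ (r t n : ℕ) :
    totalWeight r t (wordsLT (n + 1)) =
      totalWeight r t (wordsLT n) + 2 ^ n * cappedWeight r t n := by
  rw [totalWeight, wordsLT_succ, Finset.sum_union (disjoint_wordsLT_words n), totalWeight]
  congr 1
  rw [Finset.sum_congr rfl fun w hw => by rw [mem_words.mp hw], Finset.sum_const, card_words,
    smul_eq_mul]

/-- Each depth from `t` on weighs `2 ^ r`, and the `2 ^ t - 1` shallower words weigh the cap `2 ^ (r
- t)` each. -/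
theorem totalWeight_wordsLT {r t n : ℕ} (htn : t ≤ n) (hnr : n ≤ r + 1) (htr : t ≤ r) :
    totalWeight r t (wordsLT n) + 2 ^ (r - t) = (n - t + 1) * 2 ^ r := by
  have hlow : ∀ k ≤ t, totalWeight r t (wordsLT k) + 2 ^ (r - t) = 2 ^ k * 2 ^ (r - t) := by
    intro k hk
    induction k with
    | zero => simp [wordsLT, totalWeight]
    | succ k ih =>
      have := ih (by omega)
      rw [totalWeight_wordsLT_succ, cappedWeight, max_eq_right (by omega), pow_succ]
      linarith
  induction n, htn using Nat.le_induction with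
  | base => rw [hlow t le_rfl, ← pow_add]; simp; omega
  | succ n hn ih =>
    have h1 := ih (by omega)
    have h2 : 2 ^ n * cappedWeight r t n = 2 ^ r := by
      rw [cappedWeight, max_eq_left hn, ← pow_add]
      congr 1
      omega
    rw [totalWeight_wordsLT_succ, h2, show n + 1 - t + 1 = (n - t + 1) + 1 by omega, add_mul]
    linarith

variable {r : ℕ}

open Classical in
/-- The words of length less than `n` naming a vertex of `S` in the copy `c`. -/
noncomputable def wordsIn (S : Set (GluedVertex r 2)) (c : Bool) (n : ℕ) :
    Finset (List (Fin 2)) := (wordsLT n).filter fun w => vert r c w ∈ S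

theorem mem_wordsIn {S : Set (GluedVertex r 2)} {c : Bool} {n : ℕ} {w : List (Fin 2)} :
    w ∈ wordsIn S c n ↔ w.length < n ∧ vert r c w ∈ S := by
  simp [wordsIn, mem_wordsLT]

theorem totalWeight_wordsIn_add_comm (S : Set (GluedVertex r 2)) (t : ℕ) (c c' : Bool) :
    totalWeight r t (wordsIn S c (r + 1)) + totalWeight r t (wordsIn S c' r) =
      totalWeight r t (wordsIn S c' (r + 1)) + totalWeight r t (wordsIn S c r) := by
  classical
  have key : ∀ d, totalWeight r t (wordsIn S d (r + 1)) = totalWeight r t (wordsIn S d r) +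
      totalWeight r t ((words r).filter fun w => vert r false w ∈ S) := by
    intro d
    have h : wordsIn S d (r + 1) =
        wordsIn S d r ∪ (words r).filter fun w => vert r false w ∈ S := by
      ext w
      simp only [Finset.mem_union, mem_wordsIn, Finset.mem_filter, mem_words]
      constructor
      · rintro ⟨h1, h2⟩
        rcases Nat.lt_succ_iff_lt_or_eq.mp h1 with h | h
        · exact Or.inl ⟨h, h2⟩
        · exact Or.inr ⟨h, vert_eq_of_length_eq (c' := d) h ▸ h2⟩
      · rintro (⟨h1, h2⟩ | ⟨h1, h2⟩)
        · exact ⟨by omega, h2⟩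
        · exact ⟨by omega, vert_eq_of_length_eq (c' := d) h1 ▸ h2⟩
    rw [h, totalWeight, Finset.sum_union]
    · rfl
    · refine Finset.disjoint_left.mpr fun w hw hw' => ?_
      have h1 := (mem_wordsIn.mp hw).1
      have h2 := mem_words.mp (Finset.mem_filter.mp hw').1
      omega
  rw [key c, key c']
  ring

theorem IsMutualVisibilitySet.eq_or_eq {S : Set (GluedVertex r 2)} {c : Bool}
    {x y z : List (Fin 2)} (hS : IsMutualVisibilitySet (gluedBinaryTree r) S)
    (hx : x ∈ wordsIn S c (r + 1)) (hy : y ∈ wordsIn S c (r + 1)) (hz : z ∈ wordsIn S c (r + 1))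
    (hxy : x.length < r ∨ y.length < r) (hb : Between z x y) : z = x ∨ z = y := by
  rw [mem_wordsIn, Nat.lt_succ_iff] at hx hy hz
  obtain ⟨p, hp, hpS⟩ := hS _ hx.2 _ hy.2
  have := hpS _ (hp.mem_support_of_between rfl rfl hx.1 hy.1 hxy hb) hz.2
  exact this.imp (fun h => by simpa [wordOf_vert hz.1, wordOf_vert hx.1] using congrArg wordOf h)
    (fun h => by simpa [wordOf_vert hz.1, wordOf_vert hy.1] using congrArg wordOf h)

/-- The quasi-leaves are assigned to copy `c`. Only a geodesic between two of them may choose its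
copy, hence the hypothesis `h`. -/
theorem IsMutualVisibilitySet.visible {S : Set (GluedVertex r 2)} {c : Bool}
    (hS : IsMutualVisibilitySet (gluedBinaryTree r) S)
    (h : ∀ x ∈ wordsIn S c (r + 1), ∀ y ∈ wordsIn S c (r + 1), ∀ z ∈ wordsIn S c (r + 1),
      x.length = r → y.length = r → Between z x y → z = x ∨ z = y) :
    Visible (wordsIn S c (r + 1)) (wordsIn S (!c) r) := by
  have hmono : ∀ x ∈ wordsIn S (!c) r, x ∈ wordsIn S (!c) (r + 1) := fun x hx => by
    rw [mem_wordsIn] at *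
    exact ⟨by omega, hx.2⟩
  refine ⟨fun x hx y hy z hz hb => ?_, fun x hx y hy z hz hb => ?_, fun w hw v hv => ?_⟩
  · by_cases hxy : x.length < r ∨ y.length < r
    · exact hS.eq_or_eq hx hy hz hxy hb
    · have h1 := (mem_wordsIn.mp hx).1
      have h2 := (mem_wordsIn.mp hy).1
      exact h x hx y hy z hz (by omega) (by omega) hb
  · exact hS.eq_or_eq (hmono x hx) (hmono y hy) (hmono z hz) (Or.inl (mem_wordsIn.mp hx).1) hb
  · rw [mem_wordsIn] at hw hv
    rw [Nat.lt_succ_iff] at hw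
    obtain ⟨p, hp, hpS⟩ := hS _ hw.2 _ hv.2
    have hne : ∀ {u u' : List (Fin 2)} {d : Bool}, u.length ≤ r → u'.length < r →
        vert r d u = vert r (!d) u' → False := by
      intro u u' d hu hu' he
      have h1 : u = u' := by
        simpa [wordOf_vert hu, wordOf_vert hu'.le] using congrArg wordOf he
      subst h1
      have := congrArg copyOf he
      rw [copyOf_vert hu', copyOf_vert hu'] at this
      simp at this
    refine (hp.mem_support_cross rfl rfl (by simp) hw.1 hv.1).imp
      (And.imp_right fun h z hz hb => ?_) (And.imp_right fun h z hz hb => ?_)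
    · rw [mem_wordsIn, Nat.lt_succ_iff] at hz
      rcases hpS _ (h z hb) hz.2 with he | he
      · simpa [wordOf_vert hz.1, wordOf_vert hw.1] using congrArg wordOf he
      · exact (hne hz.1 hv.1 he).elim
    · rw [mem_wordsIn] at hz
      rcases hpS _ (h z hb) hz.2 with he | he
      · exact (hne hw.1 hz.1 he.symm).elim
      · simpa [wordOf_vert hz.1.le, wordOf_vert hv.1.le] using congrArg wordOf he

/-- At least one copy has no quasi-leaf pair blocked in it, and the quasi-leaves can be assigned to
that copy. Otherwise `exists_between_both` gives a pair with no free geodesic. -/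
theorem IsMutualVisibilitySet.totalWeight_le {S : Set (GluedVertex r 2)}
    (hS : IsMutualVisibilitySet (gluedBinaryTree r) S) {t : ℕ} (ht : 1 ≤ t) (htr : t ≤ r) :
    totalWeight r t (wordsIn S false (r + 1)) + totalWeight r t (wordsIn S true r) ≤
      2 ^ r + 2 ^ (r - t) := by
  have key : ∀ c, (∀ x ∈ wordsIn S c (r + 1), ∀ y ∈ wordsIn S c (r + 1),
      ∀ z ∈ wordsIn S c (r + 1), x.length = r → y.length = r → Between z x y →
      z = x ∨ z = y) → totalWeight r t (wordsIn S c (r + 1)) +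
      totalWeight r t (wordsIn S (!c) r) ≤ 2 ^ r + 2 ^ (r - t) := fun c h =>
    (hS.visible h).totalWeight_add_le ht htr
      (fun x hx => Nat.lt_succ_iff.mp (mem_wordsIn.mp hx).1)
      (fun x hx => (mem_wordsIn.mp hx).1.le)
  by_cases h1 : ∀ x ∈ wordsIn S false (r + 1), ∀ y ∈ wordsIn S false (r + 1),
      ∀ z ∈ wordsIn S false (r + 1), x.length = r → y.length = r → Between z x y → z = x ∨ z = y
  · exact key false h1
  by_cases h2 : ∀ x ∈ wordsIn S true (r + 1), ∀ y ∈ wordsIn S true (r + 1),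
      ∀ z ∈ wordsIn S true (r + 1), x.length = r → y.length = r → Between z x y → z = x ∨ z = y
  · rw [totalWeight_wordsIn_add_comm]
    exact key true h2
  exfalso
  push Not at h1 h2
  obtain ⟨x₁, hx₁, y₁, hy₁, z₁, hz₁, lx₁, ly₁, b₁, nx₁, ny₁⟩ := h1
  obtain ⟨x₂, hx₂, y₂, hy₂, z₂, hz₂, lx₂, ly₂, b₂, nx₂, ny₂⟩ := h2
  have hshort : ∀ {x y z : List (Fin 2)}, x.length = r → y.length = r → Between z x y →
      z ≠ x → z ≠ y → z.length < r := by
    intro x y z hx hy hb hzx hzy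
    rcases hb.1 with h | h
    · exact lt_of_le_of_ne (hx ▸ h.length_le) fun hl => hzx (h.eq_of_length (hl.trans hx.symm))
    · exact lt_of_le_of_ne (hy ▸ h.length_le) fun hl => hzy (h.eq_of_length (hl.trans hy.symm))
  have l₁ := hshort lx₁ ly₁ b₁ nx₁ ny₁
  have l₂ := hshort lx₂ ly₂ b₂ nx₂ ny₂
  have hleaf : ∀ {c : Bool} {x : List (Fin 2)}, x ∈ wordsIn S c (r + 1) → x.length = r →
      x.length = r ∧ vert r false x ∈ S := fun {c x} hx hl =>
    ⟨hl, vert_eq_of_length_eq (c' := c) hl ▸ (mem_wordsIn.mp hx).2⟩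
  obtain ⟨x, y, ⟨hx, hxS⟩, ⟨hy, hyS⟩, hb₁, hb₂⟩ :=
    exists_between_both (L := fun x => x.length = r ∧ vert r false x ∈ S)
      (hleaf hx₁ lx₁) (hleaf hy₁ ly₁) (hleaf hx₂ lx₂) (hleaf hy₂ ly₂) b₁ b₂
  obtain ⟨p, hp, hpS⟩ := hS _ hxS _ hyS
  have wx := wordOf_vert (c := false) hx.le
  have wy := wordOf_vert (c := false) hy.le
  obtain ⟨d, hd⟩ := hp.exists_copy_of_length_eq (by rwa [wx]) (by rwa [wy])
  rw [wx, wy] at hd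
  have hno : ∀ z : List (Fin 2), z.length < r → Between z x y → vert r d z ∉ S := by
    intro z hz hb hzS
    rcases hpS _ (hd z hb) hzS with h | h
    · have := congrArg wordOf h
      rw [wx, wordOf_vert hz.le] at this
      subst this
      omega
    · have := congrArg wordOf h
      rw [wy, wordOf_vert hz.le] at this
      subst this
      omega
  cases d
  · exact hno z₁ l₁ hb₁ (mem_wordsIn.mp hz₁).2
  · exact hno z₂ l₂ hb₂ (mem_wordsIn.mp hz₂).2

theorem MutualVisibilityColorable.lower_bound {n : ℕ}
    (h : MutualVisibilityColorable (gluedBinaryTree r) n) {t : ℕ} (ht : 1 ≤ t) (htr : t ≤ r) :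
    (2 * (r - t) + 3) * 2 ^ t ≤ n * (2 ^ t + 1) + 2 := by
  classical
  obtain ⟨col, hcol⟩ := h
  have hsum : ∀ c m, ∑ k : Fin n, totalWeight r t (wordsIn {v | col v = k} c m) =
      totalWeight r t (wordsLT m) := by
    intro c m
    rw [totalWeight, ← Finset.sum_fiberwise (wordsLT m) fun w => col (vert r c w)]
    refine Finset.sum_congr rfl fun k _ => ?_
    rw [totalWeight]
    refine Finset.sum_congr ?_ fun _ _ => rfl
    ext w
    simp [mem_wordsIn, mem_wordsLT]
  have h1 := Finset.sum_le_sum fun k (_ : k ∈ (Finset.univ : Finset (Fin n))) =>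
    (hcol k).totalWeight_le ht htr
  rw [Finset.sum_add_distrib, hsum, hsum, Finset.sum_const, Finset.card_univ, Fintype.card_fin,
    smul_eq_mul] at h1
  have h2 := totalWeight_wordsLT (n := r + 1) (by omega) le_rfl htr
  have h3 := totalWeight_wordsLT (n := r) htr (by omega) htr
  have h4 : 2 ^ r = 2 ^ t * 2 ^ (r - t) := by rw [← pow_add]; congr 1; omega
  have h5 : r + 1 - t = r - t + 1 := by omega
  rw [h5, h4] at h2
  rw [h4] at h1 h3
  refine Nat.le_of_mul_le_mul_right (c := 2 ^ (r - t)) ?_ (by positivity)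
  nlinarith

end LowerBound
-- General position colorings.
section UpperBound

variable {r : ℕ}

theorem vdist_nonneg (x y : GluedVertex r 2) : 0 ≤ vdist x y := by
  rw [← dist_eq_vdist]; positivity

theorem IsGeodesic.vdist_eq_sub {a b : GluedVertex r 2} {p : (gluedBinaryTree r).Walk a b}
    (h : IsGeodesic (gluedBinaryTree r) p) {x y : GluedVertex r 2} (hx : x ∈ p.support)
    (hy : y ∈ p.support) :
    vdist x y = vdist a y - vdist a x ∨ vdist x y = vdist a x - vdist a y := by
  have h1 := h.vdist_add hx
  have h2 := h.vdist_add hy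
  obtain ⟨q, q', rfl⟩ := SimpleGraph.Walk.mem_support_iff_exists_append.mp hx
  obtain ⟨g, g', -⟩ := h.of_append
  rcases SimpleGraph.Walk.mem_support_append_iff _ _ |>.mp hy with hy | hy
  · have := g.vdist_add hy
    rw [vdist_comm y x] at this
    omega
  · have := g'.vdist_add hy
    omega

theorem isGeneralPositionSet_of_vdist {S : Set (GluedVertex r 2)}
    (h : ∀ x ∈ S, ∀ y ∈ S, ∀ z ∈ S, x ≠ y → y ≠ z → x ≠ z → vdist x y + vdist y z ≠ vdist x z) :
    IsGeneralPositionSet (gluedBinaryTree r) S := by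
  intro a b p hp x hx y hy z hz hxp hyp hzp
  by_contra hn
  push Not at hn
  obtain ⟨hxy, hyz, hxz⟩ := hn
  have h1 := h x hx y hy z hz hxy hyz hxz
  have h2 := h y hy x hx z hz hxy.symm hxz hyz
  have h3 := h x hx z hz y hy hxz hyz.symm hxy
  rw [vdist_comm y x] at h2
  rw [vdist_comm z y] at h3
  have e1 := hp.vdist_eq_sub hxp hyp
  have e2 := hp.vdist_eq_sub hyp hzp
  have e3 := hp.vdist_eq_sub hxp hzp
  have n1 := vdist_nonneg x y
  have n2 := vdist_nonneg y z
  have n3 := vdist_nonneg x z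
  omega

theorem eq_of_copyOf_eq_of_wordOf_eq {x y : GluedVertex r 2} (h : copyOf x = copyOf y)
    (h' : wordOf x = wordOf y) : x = y := by
  rw [← vert_copyOf_wordOf x, ← vert_copyOf_wordOf y, h, h']

theorem eq_of_wordOf_eq_of_length_eq {x y : GluedVertex r 2} (h : (wordOf x).length = r)
    (h' : wordOf x = wordOf y) : x = y := by
  rw [← vert_copyOf_wordOf x, ← vert_copyOf_wordOf y, ← h']
  exact vert_eq_of_length_eq h

/-- Vertices of one depth with pairwise different words are in general position. -/
theorem isGeneralPositionSet_of_length_eq {S : Set (GluedVertex r 2)} (e : ℕ)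
    (he : ∀ x ∈ S, (wordOf x).length = e)
    (hinj : ∀ x ∈ S, ∀ y ∈ S, wordOf x = wordOf y → x = y) :
    IsGeneralPositionSet (gluedBinaryTree r) S := by
  refine isGeneralPositionSet_of_vdist fun x hx y hy z hz hxy hyz hxz hd => ?_
  have lx := he x hx
  have ly := he y hy
  have lz := he z hz
  have hr := length_wordOf_le x
  have k1 := meet_lt_of_ne (lx.trans ly.symm) fun h => hxy (hinj x hx y hy h)
  have k2 := meet_lt_of_ne (ly.trans lz.symm) fun h => hyz (hinj y hy z hz h)
  have k3 := meet_lt_of_ne (lx.trans lz.symm) fun h => hxz (hinj x hx z hz h)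
  -- Collinearity would require `meet x y + meet y z ≥ e + meet x z`, but the smaller summand is at
  -- most `meet x z` and the larger is below `e`.
  have hu := meet_ultra (wordOf x) (wordOf y) (wordOf z)
  simp only [vdist, gluedDist] at hd
  cases hcx : copyOf x <;> cases hcy : copyOf y <;> cases hcz : copyOf z <;>
    simp [hcx, hcy, hcz] at hd <;> omega

/-- The vertices of depth `e` in one copy, together with one vertex of smaller depth in the other
copy, are in general position. -/
theorem isGeneralPositionSet_of_level {S : Set (GluedVertex r 2)} (c : Bool) (e : ℕ) (her : e < r)
    (hS : ∀ x ∈ S, (copyOf x = c ∧ (wordOf x).length = e) ∨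
      (copyOf x = !c ∧ (wordOf x).length < e))
    (huniq : ∀ x ∈ S, ∀ y ∈ S, (wordOf x).length < e → (wordOf y).length < e → x = y) :
    IsGeneralPositionSet (gluedBinaryTree r) S := by
  have hlt : ∀ x ∈ S, ∀ y ∈ S, (wordOf x).length = e → x ≠ y →
      meet (wordOf x) (wordOf y) < e := by
    intro x hx y hy hxe hxy
    rcases hS y hy with hy | hy
    · rcases hS x hx with hx | hx
      · have := meet_lt_of_ne (hx.2.trans hy.2.symm) fun h =>
          hxy (eq_of_copyOf_eq_of_wordOf_eq (hx.1.trans hy.1.symm) h)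
        omega
      · omega
    · have := meet_le_right (wordOf x) (wordOf y)
      omega
  refine isGeneralPositionSet_of_vdist fun x hx y hy z hz hxy hyz hxz hd => ?_
  have hu := meet_ultra (wordOf x) (wordOf y) (wordOf z)
  have a1 := meet_le_left (wordOf x) (wordOf y)
  have a2 := meet_le_right (wordOf x) (wordOf y)
  have a3 := meet_le_right (wordOf y) (wordOf z)
  have a4 := meet_le_left (wordOf y) (wordOf z)
  have b1 := hlt x hx y hy
  have b2 := hlt y hy z hz
  have b3 := hlt x hx z hz
  have b4 := hlt z hz y hy
  rw [meet_comm] at b4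
  have u1 := huniq x hx y hy
  have u2 := huniq y hy z hz
  have u3 := huniq x hx z hz
  simp only [vdist, gluedDist] at hd
  rcases hS x hx with ⟨cx, lx⟩ | ⟨cx, lx⟩ <;> rcases hS y hy with ⟨cy, ly⟩ | ⟨cy, ly⟩ <;>
    rcases hS z hz with ⟨cz, lz⟩ | ⟨cz, lz⟩ <;>
    simp [cx, cy, cz] at hd <;> grind

theorem generalPositionColorable_card {V K : Type*} {G : SimpleGraph V} (F : Finset K)
    (col : V → K) (hF : ∀ x, col x ∈ F) (h : ∀ k ∈ F, IsGeneralPositionSet G {v | col v = k}) :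
    GeneralPositionColorable G F.card := by
  refine ⟨fun v => F.equivFin ⟨col v, hF v⟩, fun k => ?_⟩
  convert h (F.equivFin.symm k).1 (F.equivFin.symm k).2 using 1
  ext v
  simp only [Set.mem_ofPred_eq]
  rw [← Equiv.eq_symm_apply, Subtype.ext_iff]

/-- The position of a word in the enumeration of all binary words by length. -/
def index : List (Fin 2) → ℕ
  | [] => 0
  | a :: w => 2 * index w + a + 1

theorem index_lt (w : List (Fin 2)) : index w + 1 < 2 ^ (w.length + 1) := by
  induction w with
  | nil => simp [index]
  | cons a w ih =>
    rw [index, List.length_cons, pow_succ]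
    omega

theorem le_index (w : List (Fin 2)) : 2 ^ w.length ≤ index w + 1 := by
  induction w with
  | nil => simp [index]
  | cons a w ih =>
    rw [index, List.length_cons, pow_succ]
    omega

theorem index_injective : Function.Injective index := by
  intro w
  induction w with
  | nil =>
    intro v h
    cases v with
    | nil => rfl
    | cons b v => simp [index] at h
  | cons a w ih =>
    intro v h
    cases v with
    | nil => simp [index] at h
    | cons b v =>
      simp only [index] at h
      have h1 : index w = index v := by omega
      have h2 : a = b := by omega
      rw [ih h1, h2]

theorem index_lt_of_length_lt {t : ℕ} {w : List (Fin 2)} (h : w.length < t) :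
    index w + 1 < 2 ^ t :=
  (index_lt w).trans_le (Nat.pow_le_pow_right (by norm_num) h)

/-- One color serves the quasi-leaves and one each level of depth `t, …, r - 1` in each copy. The `2
^ t - 1` vertices above depth `t` go singly, by `index`, to the `r - t` levels of the other copy. -/
theorem generalPositionColorable_odd {t : ℕ} (h : 2 ^ t + t ≤ r + 1) :
    GeneralPositionColorable (gluedBinaryTree r) (2 * (r - t) + 1) := by
  classical
  have htr : t ≤ r := by have := Nat.one_le_two_pow (n := t); omega
  let col : GluedVertex r 2 → Option (Bool × ℕ) := fun x =>
    if (wordOf x).length = r then none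
    else if (wordOf x).length < t then some (!copyOf x, index (wordOf x))
    else some (copyOf x, (wordOf x).length - t)
  have hF : ∀ x, col x ∈ Finset.insertNone (Finset.univ ×ˢ Finset.range (r - t)) := by
    intro x
    have := length_wordOf_le x
    simp only [col]
    split_ifs with h1 h2
    · simp
    · have := index_lt_of_length_lt h2
      simp; omega
    · simp; omega
  have := generalPositionColorable_card _ col hF (G := gluedBinaryTree r) ?_
  · rwa [Finset.card_insertNone, Finset.card_product, Finset.card_univ, Fintype.card_bool,
      Finset.card_range] at this
  rintro (_ | ⟨c, i⟩) hk
  · have hlen : ∀ x ∈ {v | col v = none}, (wordOf x).length = r := fun x hx => by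
      simp only [col, Set.mem_ofPred_eq] at hx
      by_contra hn
      rw [if_neg hn] at hx
      split_ifs at hx
    exact isGeneralPositionSet_of_length_eq r hlen fun x hx y _ hxy =>
      eq_of_wordOf_eq_of_length_eq (hlen x hx) hxy
  · have hi : i < r - t := by simpa using hk
    refine isGeneralPositionSet_of_level c (t + i) (by omega) (fun x hx => ?_)
      (fun x hx y hy lx ly => ?_)
    · simp only [col, Set.mem_ofPred_eq] at hx
      split_ifs at hx with h1 h2
      · simp only [Option.some.injEq, Prod.mk.injEq] at hx
        exact Or.inr ⟨by simp [← hx.1], by omega⟩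
      · simp only [Option.some.injEq, Prod.mk.injEq] at hx
        exact Or.inl ⟨hx.1, by omega⟩
    · simp only [col, Set.mem_ofPred_eq] at hx hy
      split_ifs at hx hy <;> simp only [Option.some.injEq, Prod.mk.injEq] at hx hy
      · exact eq_of_copyOf_eq_of_wordOf_eq (by simpa using hx.1.trans hy.1.symm)
          (index_injective (hx.2.trans hy.2.symm))
      all_goals omega

/-- Half of depth `t` from each copy, with no word repeated, forms one class. The other halves join
the vertices above them: `3 * 2 ^ (t - 1) - 1` per copy, spread over `r - t - 1` deeper levels of
the other copy. -/
theorem generalPositionColorable_even {t : ℕ} (ht : 1 ≤ t) (h : 3 * 2 ^ (t - 1) + t ≤ r) :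
    GeneralPositionColorable (gluedBinaryTree r) (2 * (r - t)) := by
  classical
  have h2t : 2 ^ t = 2 * 2 ^ (t - 1) := by rw [← pow_succ']; congr 1; omega
  have hpos := Nat.one_le_two_pow (n := t - 1)
  let letter : Bool → Fin 2 := fun c => if c then 1 else 0
  let col : GluedVertex r 2 → Option (Option (Bool × ℕ)) := fun x =>
    if (wordOf x).length = r then none
    else if (wordOf x).length < t then some (some (!copyOf x, index (wordOf x)))
    else if (wordOf x).length = t then
      if (wordOf x).head? = some (letter (copyOf x)) then
        -- The tail has index at least `2 ^ (t - 1) - 1`, so these slots start at `2 ^ t - 1`, just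
        -- after those of the shorter words.
        some (some (!copyOf x, 2 ^ (t - 1) + index (wordOf x).tail))
      else some none
    else some (some (copyOf x, (wordOf x).length - (t + 1)))
  have hF : ∀ x, col x ∈ Finset.insertNone
      (Finset.insertNone (Finset.univ ×ˢ Finset.range (r - (t + 1)))) := by
    intro x
    have := length_wordOf_le x
    simp only [col]
    split_ifs with h1 h2 h3 h4
    · simp
    · have := index_lt_of_length_lt h2
      simp; omega
    · have := index_lt (wordOf x).tail
      rw [List.length_tail, h3, Nat.sub_add_cancel ht] at this
      simp; omega
    · simp
    · simp; omega
  have := generalPositionColorable_card _ col hF (G := gluedBinaryTree r) ?_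
  · rw [Finset.card_insertNone, Finset.card_insertNone, Finset.card_product, Finset.card_univ,
      Fintype.card_bool, Finset.card_range] at this
    convert this using 1
    omega
  rintro (_ | _ | ⟨c, i⟩) hk
  · have hlen : ∀ x ∈ {v | col v = none}, (wordOf x).length = r := fun x hx => by
      simp only [col, Set.mem_ofPred_eq] at hx
      by_contra hn
      rw [if_neg hn] at hx
      split_ifs at hx
    exact isGeneralPositionSet_of_length_eq r hlen fun x hx y _ hxy =>
      eq_of_wordOf_eq_of_length_eq (hlen x hx) hxy
  · have hlen : ∀ x ∈ {v | col v = some none}, (wordOf x).length = t ∧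
        (wordOf x).head? ≠ some (letter (copyOf x)) := fun x hx => by
      simp only [col, Set.mem_ofPred_eq] at hx
      split_ifs at hx with h1 h2 h3 h4 <;> simp at hx
      exact ⟨h3, h4⟩
    refine isGeneralPositionSet_of_length_eq t (fun x hx => (hlen x hx).1)
      fun x hx y hy hxy => eq_of_copyOf_eq_of_wordOf_eq ?_ hxy
    have hx1 := hlen x hx
    have hy2 := (hlen y hy).2
    rw [← hxy] at hy2
    obtain ⟨a, w, hw⟩ := List.exists_cons_of_length_pos (l := wordOf x) (by omega)
    rw [hw] at hx1 hy2
    cases hcx : copyOf x <;> cases hcy : copyOf y <;>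
      simp [letter, hcx, hcy] at hx1 hy2 ⊢ <;> omega
  · have hi : i < r - (t + 1) := by cases c <;> simpa using hk
    have hcls : ∀ x ∈ {v | col v = some (some (c, i))},
        (copyOf x = c ∧ (wordOf x).length = t + 1 + i) ∨
        (copyOf x = !c ∧ (wordOf x).length < t ∧ index (wordOf x) = i) ∨
        (copyOf x = !c ∧ ∃ w, w.length = t - 1 ∧ wordOf x = letter (!c) :: w ∧
          2 ^ (t - 1) + index w = i) := fun x hx => by
      simp only [col, Set.mem_ofPred_eq] at hx
      split_ifs at hx with h1 h2 h3 h4 <;>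
        simp only [Option.some.injEq, Prod.mk.injEq, reduceCtorEq] at hx
      · exact Or.inr (Or.inl ⟨by simp [← hx.1], h2, hx.2⟩)
      · have hc : copyOf x = !c := by simp [← hx.1]
        obtain ⟨a, w, hw⟩ := List.exists_cons_of_length_pos (l := wordOf x) (by omega)
        rw [hw] at h3 h4 hx
        rw [hc] at h4
        simp at h3 h4 hx
        exact Or.inr (Or.inr ⟨hc, w, by omega, by rw [hw, h4], hx.2⟩)
      · exact Or.inl ⟨hx.1, by omega⟩
    refine isGeneralPositionSet_of_level c (t + 1 + i) (by omega) (fun x hx => ?_)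
      (fun x hx y hy lx ly => ?_)
    · rcases hcls x hx with h1 | h1 | ⟨h1, w, h2, h3, -⟩
      · exact Or.inl h1
      · exact Or.inr ⟨h1.1, by omega⟩
      · exact Or.inr ⟨h1, by rw [h3, List.length_cons]; omega⟩
    · rcases hcls x hx with h1 | ⟨cx, h1, h1'⟩ | ⟨cx, w, h1, h1', h1''⟩
      · omega
      · rcases hcls y hy with h2 | ⟨cy, h2, h2'⟩ | ⟨cy, v, h2, h2', h2''⟩
        · omega
        · exact eq_of_copyOf_eq_of_wordOf_eq (cx.trans cy.symm)
            (index_injective (h1'.trans h2'.symm))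
        · have := index_lt_of_length_lt h1
          have := le_index v
          rw [h2] at this
          omega
      · rcases hcls y hy with h2 | ⟨cy, h2, h2'⟩ | ⟨cy, v, h2, h2', h2''⟩
        · omega
        · have := index_lt_of_length_lt h2
          have := le_index w
          rw [h1] at this
          omega
        · refine eq_of_copyOf_eq_of_wordOf_eq (cx.trans cy.symm) ?_
          rw [h1', h2', index_injective (show index w = index v by omega)]

end UpperBound
-- Matching the two bounds.
section Main

variable {r : ℕ}

theorem GeneralPositionColorable.mutualVisibilityColorable {n : ℕ}
    (h : GeneralPositionColorable (gluedBinaryTree r) n) :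
    MutualVisibilityColorable (gluedBinaryTree r) n := by
  obtain ⟨col, hcol⟩ := h
  refine ⟨col, fun k x hx y hy => ?_⟩
  obtain ⟨p, hp⟩ := (gluedBinaryTree_reachable x y).exists_walk_length_eq_dist
  rcases eq_or_ne x y with rfl | hxy
  · exact ⟨SimpleGraph.Walk.nil, by simp [IsGeodesic], by simp⟩
  · refine ⟨p, hp, fun z hz hzS => ?_⟩
    rcases hcol k x y p hp x hx y hy z hzS (by simp) (by simp) hz with h | h | h
    · exact absurd h hxy
    · exact Or.inr h.symm
    · exact Or.inl h.symm

theorem mutualVisibilityChromaticNumber_le_generalPositionChromaticNumber :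
    mutualVisibilityChromaticNumber (gluedBinaryTree r) ≤
      generalPositionChromaticNumber (gluedBinaryTree r) :=
  (isLeast_mutualVisibilityChromaticNumber _).2
    (isLeast_generalPositionChromaticNumber (gluedBinaryTree r)).1.mutualVisibilityColorable

theorem generalPositionChromaticNumber_eq_of_le {n : ℕ}
    (h : GeneralPositionColorable (gluedBinaryTree r) n)
    (hn : n ≤ mutualVisibilityChromaticNumber (gluedBinaryTree r)) :
    generalPositionChromaticNumber (gluedBinaryTree r) =
      mutualVisibilityChromaticNumber (gluedBinaryTree r) :=
  le_antisymm (((isLeast_generalPositionChromaticNumber _).2 h).trans hn)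
    mutualVisibilityChromaticNumber_le_generalPositionChromaticNumber

theorem exists_two_pow_add_le (hr : 2 ≤ r) :
    ∃ t, 1 ≤ t ∧ 2 ^ t + t ≤ r + 1 ∧ r + 1 < 2 ^ (t + 1) + (t + 1) := by
  have hex : ∃ t, r + 1 < 2 ^ (t + 1) + (t + 1) :=
    ⟨r, by have := Nat.lt_two_pow_self (n := r + 1); omega⟩
  obtain ⟨t, hspec, hmin⟩ : ∃ t, r + 1 < 2 ^ (t + 1) + (t + 1) ∧
      ∀ m < t, ¬ r + 1 < 2 ^ (m + 1) + (m + 1) :=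
    ⟨Nat.find hex, Nat.find_spec hex, fun _ => Nat.find_min hex⟩
  cases t with
  | zero => omega
  | succ m => exact ⟨m + 1, by omega, not_lt.mp (hmin m (by omega)), hspec⟩

end Main
end GluedTrees

theorem mainTheorem4 (r : ℕ) (hr : 2 ≤ r)
    (hne : ∀ i : ℕ, 2 ≤ i → r ≠ 2 ^ (i - 1) + 2 ^ (i - 2) + i - 2) :
    GluedTrees.generalPositionChromaticNumber (GluedTrees.gluedBinaryTree r) =
      GluedTrees.mutualVisibilityChromaticNumber (GluedTrees.gluedBinaryTree r) := by
  obtain ⟨t, ht, hlow, hup⟩ := GluedTrees.exists_two_pow_add_le hr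
  have h2t : 2 ^ t = 2 * 2 ^ (t - 1) := by rw [← pow_succ']; congr 1; omega
  have hpos := Nat.one_le_two_pow (n := t - 1)
  rw [pow_succ] at hup
  -- For `i = t + 1` the excluded value is `3 * 2 ^ (t - 1) + t - 1`, the threshold between the two
  -- colorings.
  have hexc := hne (t + 1) (by omega)
  rw [Nat.add_sub_cancel, show t + 1 - 2 = t - 1 by omega] at hexc
  have hbound := (GluedTrees.isLeast_mutualVisibilityChromaticNumber
    (GluedTrees.gluedBinaryTree r)).1.lower_bound ht (by omega)
  generalize hn : GluedTrees.mutualVisibilityChromaticNumber (GluedTrees.gluedBinaryTree r) = n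
    at hbound
  obtain ⟨m, hm⟩ : ∃ m, r = m + t := ⟨r - t, by omega⟩
  rw [show r - t = m by omega] at hbound
  rcases lt_or_gt_of_ne hexc with h | h
  · rw [← hn]
    refine GluedTrees.generalPositionChromaticNumber_eq_of_le
      (GluedTrees.generalPositionColorable_odd hlow) ?_
    rw [hn]
    by_contra hlt
    -- With at most `2m` colors the bound forces `3 * 2 ^ t ≤ 2m + 2`, so `r` would reach the
    -- excluded value.
    have : n * (2 ^ t + 1) ≤ (2 * m) * (2 ^ t + 1) := Nat.mul_le_mul_right _ (by omega)
    have : 3 * 2 ^ t ≤ 2 * m + 2 := by nlinarith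
    omega
  · rw [← hn]
    refine GluedTrees.generalPositionChromaticNumber_eq_of_le
      (GluedTrees.generalPositionColorable_even ht (by omega)) ?_
    rw [hn]
    by_contra hlt
    -- With fewer than `2m` colors the bound forces `4 * 2 ^ t ≤ 2m + 1`, against the maximality of
    -- `t`.
    have : (n + 1) * (2 ^ t + 1) ≤ (2 * m) * (2 ^ t + 1) := Nat.mul_le_mul_right _ (by omega)
    have : 4 * 2 ^ t ≤ 2 * m + 1 := by nlinarith
    omega
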